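/- Let $M$ and $N$ be smooth, finite-dimensional, Hausdorff manifolds and let $\pi : M \to N$ be a smooth (locally trivial) fibre bundle whose typical fibre is connected. A Finsler function on a manifold $M$ is a continuous function $F : TM \to [0,\infty)$ that is positively homogeneous of degree one on the fibres, smooth on $TM$ without its zero section, and strongly convex: with $E = \frac12 F^2$, the fibre Hessian $\left(\frac{\partial^2 E}{\partial u^a \partial u^b}\right)$ is positive definite at every nonzero tangent vector. For a vector field $X = X^a\frac{\partial}{\partial q^a}$ on $M$ let $X^v = X^a\frac{\partial}{\partial u^a}$ and $X^c = X^a\frac{\partial}{\partial q^a} + u^a\frac{\partial X^b}{\partial q^a}\frac{\partial}{\partial u^b}$ be its vertical and complete lifts to $TM$. Let $F_1$ be a Finsler function on $M$, with energy $E_1 = \frac12 F_1^2$, and let $S_1$ be its canonical spray, i.e. the second-order field, defined at the nonzero tangent vectors of $M$, that is determined by $S_1(X^v(E_1)) - X^c(E_1) = 0$ for all vector fields $X$ on $M$. Let $h : \pi^*TN \to TM$ be the map induced by $F_1$, determined by the requirements that $h(m,v) \in T_mM$, that $T\pi(h(m,v)) = v$, that $h$ is smooth where $v \neq 0$, and that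 $Y^v(E_1)\circ h = 0$ for every $\pi$-vertical vector field $Y$ on $M$. This $h$ exists and is homogeneous: $h(m,\lambda v) = \lambda h(m,v)$ for $\lambda > 0$. Then $S_1$ is tangent to the horizontal manifold $\operatorname{Im} h$ (at the points $h(m,v)$ with $v \ne 0$) if and only if $Y^c(E_1)\circ h = 0$ for every $\pi$-vertical vector field $Y$ on $M$. If this is the case, then there is a function $F_2 : TN \to \mathbb{R}$ with $F_2(v) = F_1(h(m,v))$ for all $m \in M$ and $v \in T_{\pi(m)}N$; this $F_2$ is a Finsler function on $N$; and $\pi : (M,F_1) \to (N,F_2)$ is a Finsler submersion, i.e. $\pi$ is surjective and, for each $m \in M$, the linear map $T_m\pi : T_mM \to T_{\pi(m)}N$ is surjective and maps the closed unit ball $\overline{\{u \in T_mM : F_1(u) < 1\}}$ onto the closed unit ball $\overline{\{v \in T_{\pi(m)}N : F_2(v) < 1\}}$. -/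

import Mathlib

open Set
open scoped Manifold ContDiff

noncomputable section

namespace FinslerSplitting

section OneManifold

variable {E : Type*} [NormedAddCommGroup E] [NormedSpace ℝ E]
  {M : Type*} [TopologicalSpace M] [ChartedSpace E M] [IsManifold 𝓘(ℝ, E) ∞ M]

/-- The slit tangent bundle: the tangent bundle without its zero section. -/
def slitTangent (E M : Type*) [NormedAddCommGroup E] [NormedSpace ℝ E] [TopologicalSpace M]
    [ChartedSpace E M] : Set (TangentBundle 𝓘(ℝ, E) M) :=
  {u | u.2 ≠ 0}

/-- The energy `½ F²` of a function on the tangent bundle. -/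
def energy (F : TangentBundle 𝓘(ℝ, E) M → ℝ) : TangentBundle 𝓘(ℝ, E) M → ℝ :=
  fun u => (1 / 2) * F u ^ 2

/-- Finsler functions. The second derivative at `t = 0` of `t ↦ ½ F(m, u + t w)²` is
`(∂²(½F²)/∂uᵃ∂uᵇ)(m, u) wᵃ wᵇ`, so that strong convexity is the positive definiteness of the
fibre Hessian of the energy at all nonzero tangent vectors. -/
structure IsFinsler (F : TangentBundle 𝓘(ℝ, E) M → ℝ) : Prop where
  nonneg : ∀ u, 0 ≤ F u
  continuous : Continuous F
  homogeneous : ∀ (m : M) (u : TangentSpace 𝓘(ℝ, E) m) (c : ℝ), 0 < c →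
    F ⟨m, c • u⟩ = c * F ⟨m, u⟩
  smooth : ContMDiffOn 𝓘(ℝ, E).tangent 𝓘(ℝ, ℝ) ∞ F (slitTangent E M)
  stronglyConvex : ∀ (m : M) (u w : TangentSpace 𝓘(ℝ, E) m), u ≠ 0 → w ≠ 0 →
    0 < iteratedDeriv 2 (fun t : ℝ => energy F ⟨m, u + t • w⟩) 0

/-- `X` is a smooth vector field on `M`. -/
def IsSmoothField (X : (m : M) → TangentSpace 𝓘(ℝ, E) m) : Prop :=
  ContMDiff 𝓘(ℝ, E) 𝓘(ℝ, E).tangent ∞ (fun m => (⟨m, X m⟩ : TangentBundle 𝓘(ℝ, E) M))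

/-- `Xᵛ(f)`: the derivative of `f` along the vertical lift `Xᵃ ∂/∂uᵃ` of `X`. -/
def vertLift (X : (m : M) → TangentSpace 𝓘(ℝ, E) m) (f : TangentBundle 𝓘(ℝ, E) M → ℝ) :
    TangentBundle 𝓘(ℝ, E) M → ℝ :=
  fun u => deriv (fun t : ℝ => f ⟨u.proj, u.2 + t • X u.proj⟩) 0

/-- The derivative `s(f)` of a function `f` on `TM` along a tangent vector `s` at `u`. -/
def dirDeriv (f : TangentBundle 𝓘(ℝ, E) M → ℝ) (u : TangentBundle 𝓘(ℝ, E) M)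
    (s : TangentSpace 𝓘(ℝ, E).tangent u) : ℝ :=
  mfderiv 𝓘(ℝ, E).tangent 𝓘(ℝ, ℝ) f u s

/-- The value at `u` of the complete lift of `X`, i.e. the image of `TX(u)` under the canonical
flip of `T(TM)`. The tangent space of `TM` at a point over `m` is `E × E`, through the chart of
`TM` induced by the preferred chart of `M` at `m`. In these coordinates `TX(u)` is the vector
`(uᵃ, (∂Xᵇ/∂qᵃ) uᵃ)` at the point `X(m)`, and the complete lift at `u` is
`Xᵃ ∂/∂qᵃ + (∂Xᵇ/∂qᵃ) uᵃ ∂/∂uᵇ`, i.e. the vector `(Xᵃ, (∂Xᵇ/∂qᵃ) uᵃ)`. -/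
def completeLiftVec (X : (m : M) → TangentSpace 𝓘(ℝ, E) m) (u : TangentBundle 𝓘(ℝ, E) M) :
    TangentSpace 𝓘(ℝ, E).tangent u :=
  let TXu : E × E := mfderiv 𝓘(ℝ, E) 𝓘(ℝ, E).tangent
    (fun m => (⟨m, X m⟩ : TangentBundle 𝓘(ℝ, E) M)) u.proj u.2
  let x : E := X u.proj
  ((x, TXu.2) : E × E)

/-- `Xᶜ(f)`: the derivative of `f` along the complete lift of `X`. -/
def completeLift (X : (m : M) → TangentSpace 𝓘(ℝ, E) m) (f : TangentBundle 𝓘(ℝ, E) M → ℝ) :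
    TangentBundle 𝓘(ℝ, E) M → ℝ :=
  fun u => dirDeriv f u (completeLiftVec X u)

/-- `s` is the value at `u` of a second-order field `S` on `TM` that satisfies
`S(Xᵛ(E)) - Xᶜ(E) = 0` at `u` for all vector fields `X` on `M`, where `E = ½ F²`. -/
def IsCanonicalSprayAt (F : TangentBundle 𝓘(ℝ, E) M → ℝ) (u : TangentBundle 𝓘(ℝ, E) M)
    (s : TangentSpace 𝓘(ℝ, E).tangent u) : Prop :=
  (mfderiv 𝓘(ℝ, E).tangent 𝓘(ℝ, E)
    (Bundle.TotalSpace.proj : TangentBundle 𝓘(ℝ, E) M → M) u s = u.2) ∧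
  ∀ X : (m : M) → TangentSpace 𝓘(ℝ, E) m, IsSmoothField X →
    dirDeriv (vertLift X (energy F)) u s - completeLift X (energy F) u = 0

/-- The canonical spray of a Finsler function `F`. By the positive definiteness of the fibre
Hessian of the energy, the relation has exactly one solution at each nonzero `u`; the spray is used
on the slit tangent bundle only. -/
def canonicalSpray (F : TangentBundle 𝓘(ℝ, E) M → ℝ) (u : TangentBundle 𝓘(ℝ, E) M) :
    TangentSpace 𝓘(ℝ, E).tangent u :=
  Classical.epsilon (IsCanonicalSprayAt F u)

end OneManifold

section TwoManifolds

variable {EM : Type*} [NormedAddCommGroup EM] [NormedSpace ℝ EM]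
  {M : Type*} [TopologicalSpace M] [ChartedSpace EM M] [IsManifold 𝓘(ℝ, EM) ∞ M]
  {EN : Type*} [NormedAddCommGroup EN] [NormedSpace ℝ EN]
  {N : Type*} [TopologicalSpace N] [ChartedSpace EN N] [IsManifold 𝓘(ℝ, EN) ∞ N]

/-- `π : M → N` is a smooth, locally trivial fibre bundle with typical fibre `Φ`. -/
def IsFibreBundle (EΦ : Type*) [NormedAddCommGroup EΦ] [NormedSpace ℝ EΦ]
    (Φ : Type*) [TopologicalSpace Φ] [ChartedSpace EΦ Φ]
    (π : C^∞⟮𝓘(ℝ, EM), M; 𝓘(ℝ, EN), N⟯) : Prop :=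
  ∀ n : N, ∃ U : Set N, IsOpen U ∧ n ∈ U ∧
    ∃ ψ : PartialDiffeomorph 𝓘(ℝ, EM) (𝓘(ℝ, EN).prod 𝓘(ℝ, EΦ)) M (N × Φ) ∞,
      ψ.source = π ⁻¹' U ∧ ψ.target = U ×ˢ univ ∧ ∀ m ∈ π ⁻¹' U, (ψ.toFun m).1 = π m

/-- The (total space of the) pullback bundle `π^*TN`, with its manifold structure. -/
abbrev PullbackTangent (π : C^∞⟮𝓘(ℝ, EM), M; 𝓘(ℝ, EN), N⟯) : Type _ :=
  Bundle.TotalSpace EN (π *ᵖ (TangentSpace 𝓘(ℝ, EN) : N → Type _))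

/-- The projection `π^*TN → TN`, `(m, v) ↦ v`. -/
def pullbackToTN (π : C^∞⟮𝓘(ℝ, EM), M; 𝓘(ℝ, EN), N⟯) (p : PullbackTangent π) :
    TangentBundle 𝓘(ℝ, EN) N :=
  Bundle.Pullback.lift π p

/-- The slit pullback bundle. -/
def slitPullback (π : C^∞⟮𝓘(ℝ, EM), M; 𝓘(ℝ, EN), N⟯) : Set (PullbackTangent π) :=
  {p | pullbackToTN π p ∈ slitTangent EN N}

/-- Nonlinear splittings `h : π^*TN → TM` on `π`. -/
structure IsNonlinearSplitting (π : C^∞⟮𝓘(ℝ, EM), M; 𝓘(ℝ, EN), N⟯)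
    (h : PullbackTangent π → TangentBundle 𝓘(ℝ, EM) M) : Prop where
  smooth : ContMDiffOn (𝓘(ℝ, EM).prod 𝓘(ℝ, EN)) 𝓘(ℝ, EM).tangent ∞ h (slitPullback π)
  proj : ∀ p, (h p).proj = p.proj
  split : ∀ p, tangentMap 𝓘(ℝ, EM) 𝓘(ℝ, EN) π (h p) = pullbackToTN π p

/-- Positive homogeneity of degree one, `h(m, c v) = c h(m, v)` for `c > 0`. -/
def IsHomogeneous (π : C^∞⟮𝓘(ℝ, EM), M; 𝓘(ℝ, EN), N⟯)
    (h : PullbackTangent π → TangentBundle 𝓘(ℝ, EM) M) : Prop :=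
  ∀ (m : M) (v : TangentSpace 𝓘(ℝ, EN) (π m)) (c : ℝ), 0 < c →
    h ⟨m, c • v⟩ = ⟨(h ⟨m, v⟩).proj, c • (h ⟨m, v⟩).2⟩

/-- `Y` is a smooth `π`-vertical vector field on `M`. -/
def IsVerticalField (π : C^∞⟮𝓘(ℝ, EM), M; 𝓘(ℝ, EN), N⟯)
    (Y : (m : M) → TangentSpace 𝓘(ℝ, EM) m) : Prop :=
  IsSmoothField Y ∧ ∀ m, mfderiv 𝓘(ℝ, EM) 𝓘(ℝ, EN) π m (Y m) = 0

/-- `h` is a nonlinear splitting on `π` with `Yᵛ(½F²) ∘ h = 0` for all vertical `Y`. -/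
def IsInducedSplitting (π : C^∞⟮𝓘(ℝ, EM), M; 𝓘(ℝ, EN), N⟯)
    (F : TangentBundle 𝓘(ℝ, EM) M → ℝ)
    (h : PullbackTangent π → TangentBundle 𝓘(ℝ, EM) M) : Prop :=
  IsNonlinearSplitting π h ∧
  ∀ Y : (m : M) → TangentSpace 𝓘(ℝ, EM) m, IsVerticalField π Y →
    ∀ p, vertLift Y (energy F) (h p) = 0

/-- The nonlinear splitting on `π` induced by the Finsler function `F`. -/
def inducedSplitting (π : C^∞⟮𝓘(ℝ, EM), M; 𝓘(ℝ, EN), N⟯)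
    (F : TangentBundle 𝓘(ℝ, EM) M → ℝ) : PullbackTangent π → TangentBundle 𝓘(ℝ, EM) M :=
  @Classical.epsilon _ ⟨fun p => ⟨p.proj, 0⟩⟩ (IsInducedSplitting π F)

/-- A field `S` on `TM` is tangent to the horizontal manifold `Im h`: for `p` in the slit pullback
bundle, where `h` is an embedding, the tangent space of `Im h` at `h p` is the range of the
differential of `h` at `p`. -/
def IsTangentToImage (π : C^∞⟮𝓘(ℝ, EM), M; 𝓘(ℝ, EN), N⟯)
    (h : PullbackTangent π → TangentBundle 𝓘(ℝ, EM) M)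
    (S : (u : TangentBundle 𝓘(ℝ, EM) M) → TangentSpace 𝓘(ℝ, EM).tangent u) : Prop :=
  ∀ p ∈ slitPullback π,
    S (h p) ∈ range (mfderiv (𝓘(ℝ, EM).prod 𝓘(ℝ, EN)) 𝓘(ℝ, EM).tangent h p)

/-- The closed unit ball in `T_m M` of a function on `TM`: the closure of the open unit ball. -/
def closedUnitBall (F : TangentBundle 𝓘(ℝ, EM) M → ℝ) (m : M) :
    Set (TangentSpace 𝓘(ℝ, EM) m) :=
  closure {u | F ⟨m, u⟩ < 1}

/-- Finsler submersions `(M, F₁) → (N, F₂)`: every differential is surjective and maps the closed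
unit ball onto the closed unit ball. -/
structure IsFinslerSubmersion (π : C^∞⟮𝓘(ℝ, EM), M; 𝓘(ℝ, EN), N⟯)
    (F₁ : TangentBundle 𝓘(ℝ, EM) M → ℝ) (F₂ : TangentBundle 𝓘(ℝ, EN) N → ℝ) : Prop where
  finsler_total : IsFinsler F₁
  finsler_base : IsFinsler F₂
  surjective : Function.Surjective π
  mfderiv_surjective : ∀ m, Function.Surjective (mfderiv 𝓘(ℝ, EM) 𝓘(ℝ, EN) π m)
  image_ball : ∀ m, mfderiv 𝓘(ℝ, EM) 𝓘(ℝ, EN) π m '' closedUnitBall F₁ m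
    = closedUnitBall F₂ (π m)

end TwoManifolds

end FinslerSplitting

end

/-!
The proof reads everything through the Lagrange multipliers of the following variational problem.
For `v ∈ T_{π(m)}N`, the vectors `u ∈ T_mM` with `Tπ(u) = v` form an affine subspace. The energy
`E = ½ F₁²` is strictly convex along lines that avoid the origin and coercive, so it has exactly one
stationary point on this subspace, which is its minimum (`IsMinkowskiEnergy.exists_stationary`,
`IsMinkowskiEnergy.lt_of_stationary`). This point is `h(m, v)`: vertical fields take all vertical
values (`exists_verticalField`), so `Yᵛ(E) ∘ h = 0` for all vertical `Y` says that `E` is stationary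
along the vertical directions (`inducedSplitting_eq_horizontalMap`). Homogeneity of `h` is immediate
from uniqueness.

In charts let `e(x, u)` be the energy, `f` the projection and `g(x, v)` the fibre coordinate of
`h`. Then `g` and a multiplier `λ(x, v)` solve `Df(x) g = v`, `∂ᵤe(x, g) = λ ∘ Df(x)`. The
derivative of this system in `(g, λ)` is invertible, since `∂ᵤ²e` is positive definite and `Df(x)`
surjective, and the implicit function theorem makes `g` and `λ` smooth off the zero vectors
(`exists_isLocalSplitting`, `exists_isLocalSplitting_horizontalLift`).

With `u₀ = g(x, v)`, consider the linear form `C(y) = ∂ₓe · y - λ(D²f(y, u₀))` on the vertical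
vectors `y ∈ ker Df(x)`. Differentiating the Lagrange system shows that it plays three roles.
* The spray `(u₀, s)`, which satisfies `D²e (u₀, s) (0, y) = ∂ₓe · y`, is tangent to the graph of
  `g` if and only if `C = 0` (`IsLocalSplitting.exists_fderiv_eq_iff`).
* If `Y` is vertical, then `Yᶜ(E)` at `h(m, v)` is `C(Y(x))`, because differentiating `Df · Y = 0`
  gives `Df(DY u₀) = -D²f(Y, u₀)` (`IsLocalSplitting.fderiv_energy_completeLift`).
* For fixed `v`, the derivative of `E ∘ h` along `y` is `C(y)`
  (`IsLocalSplitting.hasFDerivAt_energy_splitting`).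
The first two give the equivalence (`isTangentToImage_iff`). By the third, tangency implies that
`F₁ ∘ h` is constant along the connected fibres, so that it descends to a function `F₂` on `TN`
(`map_horizontalLift_eq`).

By construction `F₂(v)` is the least length of a lift of `v` to any point over its base point.
Hence `F₂ ∘ Tπ ≤ F₁`, with equality on horizontal vectors, which gives the statement about unit
balls, and the bound `F₂ ≤ F₁ ∘ Tσ` for a local section `σ` gives continuity of `F₂` at the zero
vectors. Smoothness off the zero vectors holds as `F₂(v) = F₁(h(σ(n), v))` locally. Finally, by the
Lagrange condition the fibre derivative of `½ F₂²` is `λ`, and the derivative of `λ` along `w` is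
`∂ᵤ²e (w', w')` with `w' = ∂ᵥg · w ≠ 0`, which is positive
(`IsLocalSplitting.iteratedDeriv_two_energy_pos`).
-/

noncomputable section

namespace FinslerSplitting

open Filter Topology
open Bundle (TotalSpace)

/-! ### Energies of Minkowski norms on a vector space -/

section Minkowski

variable {V W : Type*} [NormedAddCommGroup V] [NormedSpace ℝ V]
  [NormedAddCommGroup W] [NormedSpace ℝ W]

/-- A function of class `C²` restricted to an affine line has as its second derivative the Hessian
evaluated on the direction of the line. -/
theorem iteratedDeriv_two_line {ε : V → ℝ} {u : V} (h : ContDiffAt ℝ 2 ε u) (w : V) :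
    iteratedDeriv 2 (fun t : ℝ => ε (u + t • w)) 0 = fderiv ℝ (fderiv ℝ ε) u w w := by
  have hl : ∀ t : ℝ, HasDerivAt (fun t : ℝ => u + t • w) w t := fun t => by
    simpa using ((hasDerivAt_id t).smul_const w).const_add u
  have hev : ∀ᶠ y in 𝓝 u, ContDiffAt ℝ 2 ε y := h.eventually (by simp)
  have hcont : Tendsto (fun t : ℝ => u + t • w) (𝓝 0) (𝓝 u) := by
    have := (hl 0).continuousAt.tendsto
    simpa using this
  have h1 : deriv (fun t : ℝ => ε (u + t • w)) =ᶠ[𝓝 0] fun t => fderiv ℝ ε (u + t • w) w := by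
    filter_upwards [hcont.eventually hev] with t ht
    exact ((ht.differentiableAt (by simp)).hasFDerivAt.comp_hasDerivAt t (hl t)).deriv
  rw [iteratedDeriv_succ, iteratedDeriv_one, h1.deriv_eq]
  have h2 : DifferentiableAt ℝ (fderiv ℝ ε) u :=
    (h.fderiv_right (m := 1) (by norm_num)).differentiableAt (by simp)
  have h3 : HasDerivAt (fun t : ℝ => fderiv ℝ ε (u + t • w)) (fderiv ℝ (fderiv ℝ ε) u w) 0 :=
    h2.hasFDerivAt.comp_hasDerivAt_of_eq (0 : ℝ) (hl 0) (by simp)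
  exact ((ContinuousLinearMap.apply ℝ ℝ w).hasFDerivAt.comp_hasDerivAt (0 : ℝ) h3).deriv

/-- The energies `½F²` of Minkowski norms, i.e. of Finsler functions on a vector space. -/
structure IsMinkowskiEnergy (ε : V → ℝ) : Prop where
  nonneg : ∀ u, 0 ≤ ε u
  continuous : Continuous ε
  homogeneous : ∀ (u : V) (c : ℝ), 0 < c → ε (c • u) = c ^ 2 * ε u
  contDiffAt : ∀ u, u ≠ 0 → ContDiffAt ℝ ∞ ε u
  hessian_pos : ∀ u w, u ≠ 0 → w ≠ 0 → 0 < fderiv ℝ (fderiv ℝ ε) u w w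

namespace IsMinkowskiEnergy

variable {ε : V → ℝ} (hε : IsMinkowskiEnergy ε)
include hε

theorem map_zero : ε 0 = 0 := by
  have := hε.homogeneous 0 2 (by norm_num)
  rw [smul_zero] at this
  linarith

theorem differentiableAt {u : V} (hu : u ≠ 0) : DifferentiableAt ℝ ε u :=
  (hε.contDiffAt u hu).differentiableAt (by simp)

theorem hasDerivAt_line {u w : V} {t : ℝ} (h : u + t • w ≠ 0) :
    HasDerivAt (fun t : ℝ => ε (u + t • w)) (fderiv ℝ ε (u + t • w) w) t := by
  have hl : HasDerivAt (fun t : ℝ => u + t • w) w t := by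
    simpa using ((hasDerivAt_id t).smul_const w).const_add u
  exact (hε.differentiableAt h).hasFDerivAt.comp_hasDerivAt t hl

theorem deriv_line {u : V} (hu : u ≠ 0) (w : V) :
    deriv (fun t : ℝ => ε (u + t • w)) 0 = fderiv ℝ ε u w := by
  have := (hε.hasDerivAt_line (u := u) (w := w) (t := 0) (by simpa using hu)).deriv
  simpa using this

theorem radial_eventuallyEq (u : V) :
    (fun t : ℝ => ε (u + t • u)) =ᶠ[𝓝 0] fun t => (1 + t) ^ 2 * ε u := by
  filter_upwards [eventually_gt_nhds (show (-1 : ℝ) < 0 by norm_num)] with t ht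
  rw [← hε.homogeneous u (1 + t) (by linarith), add_smul, one_smul]

/-- Euler's relation for a function that is positively homogeneous of degree two. -/
theorem deriv_radial (u : V) : deriv (fun t : ℝ => ε (u + t • u)) 0 = 2 * ε u := by
  rw [(hε.radial_eventuallyEq u).deriv_eq]
  have : HasDerivAt (fun t : ℝ => (1 + t) ^ 2 * ε u) (2 * ε u) 0 := by
    have := (((hasDerivAt_id (0 : ℝ)).const_add 1).pow 2).mul_const (ε u)
    simpa using this
  exact this.deriv

theorem pos {u : V} (hu : u ≠ 0) : 0 < ε u := by
  have h := hε.hessian_pos u u hu hu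
  rw [← iteratedDeriv_two_line ((hε.contDiffAt u hu).of_le (WithTop.coe_le_coe.2 le_top)) u,
    iteratedDeriv_succ, iteratedDeriv_one, ((hε.radial_eventuallyEq u).deriv).deriv_eq] at h
  have h1 : deriv (fun t : ℝ => (1 + t) ^ 2 * ε u) = fun t => 2 * (1 + t) * ε u := by
    ext t
    have := (((hasDerivAt_id t).const_add 1).pow 2).mul_const (ε u)
    simpa using this.deriv
  have h2 : HasDerivAt (fun t : ℝ => 2 * (1 + t) * ε u) (2 * ε u) 0 := by
    have := (((hasDerivAt_id (0 : ℝ)).const_add 1).const_mul 2).mul_const (ε u)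
    simpa using this
  rw [h1, h2.deriv] at h
  linarith

theorem hasDerivAt_fderiv_line {u w : V} {t : ℝ} (h : u + t • w ≠ 0) :
    HasDerivAt (fun t : ℝ => fderiv ℝ ε (u + t • w) w)
      (fderiv ℝ (fderiv ℝ ε) (u + t • w) w w) t := by
  have hl : HasDerivAt (fun t : ℝ => u + t • w) w t := by
    simpa using ((hasDerivAt_id t).smul_const w).const_add u
  have h2 : DifferentiableAt ℝ (fderiv ℝ ε) (u + t • w) :=
    ((hε.contDiffAt _ h).fderiv_right (m := 1) (WithTop.coe_le_coe.2 le_top)).differentiableAt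
      (by simp)
  exact (ContinuousLinearMap.apply ℝ ℝ w).hasFDerivAt.comp_hasDerivAt t
    (h2.hasFDerivAt.comp_hasDerivAt t hl)

/-- A stationary point of the energy along a line that avoids the origin is a strict minimum. -/
theorem lt_of_stationary_line {u w : V} (hl : ∀ t : ℝ, u + t • w ≠ 0) (hw : w ≠ 0)
    (h0 : fderiv ℝ ε u w = 0) : ε u < ε (u + w) := by
  have hmono : StrictMono fun t : ℝ => fderiv ℝ ε (u + t • w) w :=
    strictMono_of_hasDerivAt_pos (fun t => hε.hasDerivAt_fderiv_line (hl t))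
      (fun t => hε.hessian_pos _ _ (hl t) hw)
  have hφ : StrictMonoOn (fun t : ℝ => ε (u + t • w)) (Icc 0 1) := by
    refine strictMonoOn_of_deriv_pos (convex_Icc 0 1)
      (fun t _ => (hε.hasDerivAt_line (hl t)).continuousAt.continuousWithinAt) fun t ht => ?_
    rw [interior_Icc] at ht
    rw [(hε.hasDerivAt_line (hl t)).deriv]
    simpa [h0] using hmono ht.1
  simpa using hφ (left_mem_Icc.2 zero_le_one) (right_mem_Icc.2 zero_le_one) zero_lt_one

/-- A point of an affine subspace at which the energy is stationary along that subspace is its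
strict minimum there. The affine subspace is given as a fibre of a linear map. -/
theorem lt_of_stationary (L : V →L[ℝ] W) {u : V}
    (hst : ∀ y, L y = 0 → deriv (fun t : ℝ => ε (u + t • y)) 0 = 0) {u' : V} (hL : L u' = L u)
    (hne : u' ≠ u) : ε u < ε u' := by
  by_cases hv : L u = 0
  · have hu : u = 0 := by
      by_contra hu
      have := hst u hv
      rw [hε.deriv_radial] at this
      linarith [hε.pos hu]
    subst hu
    rw [hε.map_zero]
    exact hε.pos hne
  · have hw : L (u' - u) = 0 := by rw [map_sub, hL, sub_self]
    have hline : ∀ t : ℝ, u + t • (u' - u) ≠ 0 := fun t h => hv <| by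
      have := congrArg L h
      simpa [hw] using this
    have hu : u ≠ 0 := fun h => hv (by rw [h, _root_.map_zero])
    have := hε.lt_of_stationary_line hline (sub_ne_zero.2 hne)
      (by rw [← hε.deriv_line hu]; exact hst _ hw)
    simpa using this

theorem eq_of_stationary (L : V →L[ℝ] W) {u u' : V} (hL : L u' = L u)
    (hst : ∀ y, L y = 0 → deriv (fun t : ℝ => ε (u + t • y)) 0 = 0)
    (hst' : ∀ y, L y = 0 → deriv (fun t : ℝ => ε (u' + t • y)) 0 = 0) : u' = u := by
  by_contra hne
  exact lt_asymm (hε.lt_of_stationary L hst hL hne)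
    (hε.lt_of_stationary L hst' hL.symm (Ne.symm hne))

/-- Compactness of the unit sphere and homogeneity bound the energy below by the squared norm, so
that it is coercive. -/
theorem exists_norm_sq_le [FiniteDimensional ℝ V] : ∃ c > 0, ∀ u, c * ‖u‖ ^ 2 ≤ ε u := by
  obtain hS | hS := (Metric.sphere (0 : V) 1).eq_empty_or_nonempty
  · refine ⟨1, one_pos, fun u => ?_⟩
    have hu : u = 0 := by
      by_contra hu
      have : ‖u‖⁻¹ • u ∈ Metric.sphere (0 : V) 1 := by
        simp [norm_smul, inv_mul_cancel₀ (norm_ne_zero_iff.2 hu)]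
      simp [hS] at this
    simp [hu, hε.map_zero]
  · obtain ⟨a, ha, hmin⟩ := (isCompact_sphere (0 : V) 1).exists_isMinOn hS
      hε.continuous.continuousOn
    refine ⟨ε a, hε.pos (by rintro rfl; simp at ha), fun u => ?_⟩
    by_cases hu : u = 0
    · simp [hu, hε.map_zero]
    · have hn : 0 < ‖u‖ := norm_pos_iff.2 hu
      have h1 : ‖u‖⁻¹ • u ∈ Metric.sphere (0 : V) 1 := by
        simp [norm_smul, inv_mul_cancel₀ hn.ne']
      have h2 : ε u = ‖u‖ ^ 2 * ε (‖u‖⁻¹ • u) := by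
        rw [← hε.homogeneous _ _ hn, smul_smul, mul_inv_cancel₀ hn.ne', one_smul]
      rw [h2, mul_comm]
      gcongr
      exact hmin h1

/-- On every fibre of a surjective linear map there is a point at which the energy is stationary
along the fibre: the energy is coercive, so that it has a minimum. -/
theorem exists_stationary [FiniteDimensional ℝ V] (L : V →L[ℝ] W) (hL : Function.Surjective L)
    (v : W) : ∃ u, L u = v ∧ ∀ y, L y = 0 → deriv (fun t : ℝ => ε (u + t • y)) 0 = 0 := by
  obtain ⟨c, hc, hle⟩ := hε.exists_norm_sq_le
  obtain ⟨u₀, hu₀⟩ := hL v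
  have hclosed : IsClosed {u | L u = v} := isClosed_eq L.continuous continuous_const
  have htop : Tendsto ε (cocompact V) atTop := by
    refine tendsto_atTop_mono hle ?_
    exact ((tendsto_pow_atTop two_ne_zero).comp (tendsto_norm_cocompact_atTop)).const_mul_atTop hc
  obtain ⟨u, hu, hmin⟩ := hε.continuous.continuousOn.exists_isMinOn' hclosed hu₀
    ((htop.eventually_ge_atTop (ε u₀)).filter_mono inf_le_left)
  refine ⟨u, hu, fun y hy => ?_⟩
  refine IsLocalMin.deriv_eq_zero (Eventually.of_forall fun t => ?_)
  have := hmin (show u + t • y ∈ {u | L u = v} by simp [hy, show L u = v from hu])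
  simpa using this

end IsMinkowskiEnergy

end Minkowski

/-! ### The induced splitting and the spray in charts -/

section LocalCalculus

variable {E F : Type*} [NormedAddCommGroup E] [NormedSpace ℝ E]
  [NormedAddCommGroup F] [NormedSpace ℝ F]

/-- The local form of the splitting induced by an energy. Here `e (x, u)` is the energy and `f` the
projection, both written in charts, and `g (x, v)` is the fibre coordinate of `h (x, v)`. That
`D_u e (x, g)` vanishes on `ker (Df x)` is expressed by a Lagrange multiplier `lam`. -/
structure IsLocalSplitting (e : E × E → ℝ) (f : E → F) (g : E × F → E) (lam : E × F → F →L[ℝ] ℝ)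
    (x₀ : E) (v₀ : F) (u₀ : E) : Prop where
  apply_self : g (x₀, v₀) = u₀
  contDiffAt_energy : ContDiffAt ℝ ∞ e (x₀, u₀)
  contDiffAt_proj : ContDiffAt ℝ ∞ f x₀
  contDiffAt_splitting : ContDiffAt ℝ ∞ g (x₀, v₀)
  contDiffAt_multiplier : ContDiffAt ℝ ∞ lam (x₀, v₀)
  split : ∀ᶠ q in 𝓝 (x₀, v₀), fderiv ℝ f q.1 (g q) = q.2
  lagrange : ∀ᶠ q in 𝓝 (x₀, v₀), ∀ y,
    fderiv ℝ e (q.1, g q) (0, y) = lam q (fderiv ℝ f q.1 y)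
  hessian_pos : ∀ w, w ≠ 0 → 0 < fderiv ℝ (fderiv ℝ e) (x₀, u₀) (0, w) (0, w)

theorem hasFDerivAt_fderiv {e : E → F} {p : E} (h : ContDiffAt ℝ ∞ e p) :
    HasFDerivAt (fderiv ℝ e) (fderiv ℝ (fderiv ℝ e) p) p :=
  ((h.fderiv_right (m := 1) (WithTop.coe_le_coe.2 le_top)).differentiableAt (by simp)).hasFDerivAt

theorem fderiv_fderiv_symm {e : E → F} {p : E} (h : ContDiffAt ℝ ∞ e p) (v w : E) :
    fderiv ℝ (fderiv ℝ e) p v w = fderiv ℝ (fderiv ℝ e) p w v :=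
  (h.isSymmSndFDerivAt (by
    rw [minSmoothness_of_isRCLikeNormedField]; exact WithTop.coe_le_coe.2 le_top)).eq v w

theorem finrank_strongDual (E : Type*) [NormedAddCommGroup E] [NormedSpace ℝ E]
    [FiniteDimensional ℝ E] : Module.finrank ℝ (E →L[ℝ] ℝ) = Module.finrank ℝ E := by
  rw [← (LinearMap.toContinuousLinearMap (𝕜 := ℝ) (E := E) (F' := ℝ)).finrank_eq]
  exact Subspace.dual_finrank_eq

/-- The implicit function theorem for the Lagrange system `Df(x) u = v`, `D_u e (x, u) = λ ∘ Df(x)`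
in the unknowns `u` and `λ`. It applies as the fibre Hessian of `e` is positive definite and `Df(x)`
is surjective. -/
theorem exists_isLocalSplitting [FiniteDimensional ℝ E] [FiniteDimensional ℝ F]
    {e : E × E → ℝ} {f : E → F} {x₀ u₀ : E}
    (he : ContDiffAt ℝ ∞ e (x₀, u₀)) (hf : ContDiffAt ℝ ∞ f x₀)
    (hsurj : Function.Surjective (fderiv ℝ f x₀))
    (hst : ∀ y, fderiv ℝ f x₀ y = 0 → fderiv ℝ e (x₀, u₀) (0, y) = 0)
    (hpos : ∀ w, w ≠ 0 → 0 < fderiv ℝ (fderiv ℝ e) (x₀, u₀) (0, w) (0, w)) :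
    ∃ g lam, IsLocalSplitting e f g lam x₀ (fderiv ℝ f x₀ u₀) u₀ := by
  obtain ⟨R, hR⟩ := (fderiv ℝ f x₀).exists_rightInverse_of_surjective
    (LinearMap.range_eq_top.2 hsurj)
  have hR' : ∀ v, fderiv ℝ f x₀ (R v) = v := fun v => DFunLike.congr_fun hR v
  set ι : E →L[ℝ] E × E := .inr ℝ E E with hι
  set lam₀ : F →L[ℝ] ℝ := (fderiv ℝ e (x₀, u₀)).comp (ι.comp R) with hlam
  have hlam₀ : ∀ y, fderiv ℝ e (x₀, u₀) (0, y) = lam₀ (fderiv ℝ f x₀ y) := fun y => by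
    have := hst (y - R (fderiv ℝ f x₀ y)) (by rw [map_sub, hR', sub_self])
    have h2 : ((0 : E), y - R (fderiv ℝ f x₀ y)) = (0, y) - (0, R (fderiv ℝ f x₀ y)) := by simp
    rw [h2, map_sub, sub_eq_zero] at this
    simp [this, hlam, hι]
  let G : (E × F) × (E × (F →L[ℝ] ℝ)) → F × (E →L[ℝ] ℝ) := fun z =>
    (fderiv ℝ f z.1.1 z.2.1 - z.1.2,
      (fderiv ℝ e (z.1.1, z.2.1)).comp ι - z.2.2.comp (fderiv ℝ f z.1.1))
  set v₀ := fderiv ℝ f x₀ u₀ with hv₀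
  let z₀ : (E × F) × (E × (F →L[ℝ] ℝ)) := ((x₀, v₀), (u₀, lam₀))
  have hdf : ContDiffAt ℝ ∞ (fun z : (E × F) × (E × (F →L[ℝ] ℝ)) => fderiv ℝ f z.1.1) z₀ :=
    (hf.fderiv_right (m := ∞) (by simp)).comp z₀ contDiffAt_fst.fst
  have hpair : ContDiffAt ℝ ∞
      (fun z : (E × F) × (E × (F →L[ℝ] ℝ)) => (z.1.1, z.2.1)) z₀ :=
    contDiffAt_fst.fst.prodMk contDiffAt_snd.fst
  have hde : ContDiffAt ℝ ∞
      (fun z : (E × F) × (E × (F →L[ℝ] ℝ)) => fderiv ℝ e (z.1.1, z.2.1)) z₀ :=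
    ContDiffAt.comp z₀ (g := fderiv ℝ e) (he.fderiv_right (m := ∞) (by simp)) hpair
  have hG : ContDiffAt ℝ ∞ G z₀ :=
    ((hdf.clm_apply contDiffAt_snd.fst).sub contDiffAt_fst.snd).prodMk
      ((hde.clm_comp contDiffAt_const).sub (contDiffAt_snd.snd.clm_comp hdf))
  -- The derivative in the unknowns is `(u', λ') ↦ (Df u', D_u² e u' - λ' ∘ Df)`.
  have hA : ∀ (u' : E) (l' : F →L[ℝ] ℝ), fderiv ℝ G z₀ (0, (u', l')) =
      (fderiv ℝ f x₀ u', (fderiv ℝ (fderiv ℝ e) (x₀, u₀) (0, u')).comp ι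
        - l'.comp (fderiv ℝ f x₀)) := by
    intro u' l'
    have hd := (hG.differentiableAt (by simp)).hasFDerivAt
    have hl : HasDerivAt (fun t : ℝ => z₀ + t • ((0, (u', l')) : (E × F) × (E × (F →L[ℝ] ℝ))))
        (0, (u', l')) 0 := by
      simpa using ((hasDerivAt_id (0 : ℝ)).smul_const
        ((0, (u', l')) : (E × F) × (E × (F →L[ℝ] ℝ)))).const_add z₀
    have h1 := hd.comp_hasDerivAt_of_eq (0 : ℝ) hl (by simp)
    have h2 : HasDerivAt (fun t : ℝ => u₀ + t • u') u' 0 := by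
      simpa using ((hasDerivAt_id (0 : ℝ)).smul_const u').const_add u₀
    have h3 : HasDerivAt (fun t : ℝ => lam₀ + t • l') l' 0 := by
      simpa using ((hasDerivAt_id (0 : ℝ)).smul_const l').const_add lam₀
    have h4 : HasDerivAt (fun t : ℝ => fderiv ℝ e (x₀, u₀ + t • u'))
        (fderiv ℝ (fderiv ℝ e) (x₀, u₀) (0, u')) 0 :=
      (hasFDerivAt_fderiv he).comp_hasDerivAt_of_eq (0 : ℝ)
        ((hasDerivAt_const (0 : ℝ) x₀).prodMk h2) (by simp)
    have h5 : HasDerivAt (fun t : ℝ => (fderiv ℝ e (x₀, u₀ + t • u')).comp ι)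
        ((fderiv ℝ (fderiv ℝ e) (x₀, u₀) (0, u')).comp ι) 0 :=
      ((ContinuousLinearMap.compL ℝ E (E × E) ℝ).flip ι).hasFDerivAt.comp_hasDerivAt (0 : ℝ) h4
    have h6 : HasDerivAt (fun t : ℝ => (lam₀ + t • l').comp (fderiv ℝ f x₀))
        (l'.comp (fderiv ℝ f x₀)) 0 :=
      ((ContinuousLinearMap.compL ℝ E F ℝ).flip (fderiv ℝ f x₀)).hasFDerivAt.comp_hasDerivAt
        (0 : ℝ) h3
    have h7 : HasDerivAt (fun t : ℝ => fderiv ℝ f x₀ (u₀ + t • u') - v₀) (fderiv ℝ f x₀ u') 0 :=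
      ((fderiv ℝ f x₀).hasFDerivAt.comp_hasDerivAt (0 : ℝ) h2).sub_const v₀
    have h8 := h7.prodMk (h5.sub h6)
    refine h1.unique (h8.congr_of_eventuallyEq (Eventually.of_forall fun t => ?_))
    simp [G, z₀]
  have hinj : Function.Injective (fderiv ℝ G z₀ ∘L .inr ℝ (E × F) (E × (F →L[ℝ] ℝ))) := by
    rw [injective_iff_map_eq_zero]
    rintro ⟨u', l'⟩ h
    replace h : fderiv ℝ G z₀ (0, (u', l')) = 0 := h
    rw [hA, Prod.mk_eq_zero] at h
    obtain ⟨h1, h2⟩ := h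
    have hu : u' = 0 := by
      by_contra hu
      have := DFunLike.congr_fun h2 u'
      have hp := hpos u' hu
      simp [h1, hι] at this
      linarith
    subst hu
    have hl : l' = 0 := by
      ext v
      have := DFunLike.congr_fun h2 (R v)
      have h0 : ((0 : E), (0 : E)) = 0 := rfl
      simpa [hR', h0] using this
    rw [hl]; rfl
  have hdim : Module.finrank ℝ (E × (F →L[ℝ] ℝ)) = Module.finrank ℝ (F × (E →L[ℝ] ℝ)) := by
    rw [Module.finrank_prod, Module.finrank_prod, finrank_strongDual F,
      finrank_strongDual E, add_comm]
  have hinv : (fderiv ℝ G z₀ ∘L .inr ℝ (E × F) (E × (F →L[ℝ] ℝ))).IsInvertible := by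
    refine ⟨(LinearEquiv.ofInjectiveOfFinrankEq _ hinj hdim).toContinuousLinearEquiv, ?_⟩
    ext x <;> rfl
  have hG0 : G z₀ = 0 := by
    refine Prod.ext (by simp [G, z₀, hv₀]) ?_
    ext y
    simp [G, z₀, hι, hlam₀ y]
  let φ := hG.implicitFunction (by simp) hinv
  have hφ : ContDiffAt ℝ ∞ φ (x₀, v₀) := hG.contDiffAt_implicitFunction (by simp) hinv
  have hφ0 : φ (x₀, v₀) = (u₀, lam₀) := hG.implicitFunction_apply_self (by simp) hinv
  have hφG : ∀ᶠ q in 𝓝 (x₀, v₀), G (q, φ q) = 0 := by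
    rw [← hG0]
    exact hG.eventually_apply_implicitFunction (by simp) hinv
  refine ⟨fun q => (φ q).1, fun q => (φ q).2, by rw [hφ0], he, hf, hφ.fst, hφ.snd, ?_, ?_, hpos⟩
  · filter_upwards [hφG] with q hq
    exact sub_eq_zero.1 (Prod.ext_iff.1 hq).1
  · filter_upwards [hφG] with q hq y
    exact DFunLike.congr_fun (sub_eq_zero.1 (Prod.ext_iff.1 hq).2) y

namespace IsLocalSplitting

variable {e : E × E → ℝ} {f : E → F} {g : E × F → E} {lam : E × F → F →L[ℝ] ℝ}
  {x₀ u₀ : E} {v₀ : F} (H : IsLocalSplitting e f g lam x₀ v₀ u₀)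
include H

theorem hasFDerivAt_splitting : HasFDerivAt g (fderiv ℝ g (x₀, v₀)) (x₀, v₀) :=
  (H.contDiffAt_splitting.differentiableAt (by simp)).hasFDerivAt

theorem hasFDerivAt_energy : HasFDerivAt e (fderiv ℝ e (x₀, u₀)) (x₀, u₀) :=
  (H.contDiffAt_energy.differentiableAt (by simp)).hasFDerivAt

theorem lagrange_self (y : E) :
    fderiv ℝ e (x₀, u₀) (0, y) = lam (x₀, v₀) (fderiv ℝ f x₀ y) := by
  have := H.lagrange.self_of_nhds y
  rwa [H.apply_self] at this

/-- The derivative of the identity `Df(x) g(x, v) = v`. -/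
theorem fderiv_split (a : E) (b : F) :
    fderiv ℝ (fderiv ℝ f) x₀ a u₀ + fderiv ℝ f x₀ (fderiv ℝ g (x₀, v₀) (a, b)) = b := by
  have h1 : HasFDerivAt (fun q : E × F => fderiv ℝ f q.1)
      ((fderiv ℝ (fderiv ℝ f) x₀).comp (.fst ℝ E F)) (x₀, v₀) :=
    HasFDerivAt.comp (x₀, v₀) (g := fderiv ℝ f) (hasFDerivAt_fderiv H.contDiffAt_proj)
      hasFDerivAt_fst
  have h2 := h1.clm_apply H.hasFDerivAt_splitting
  have h3 : HasFDerivAt (fun q : E × F => fderiv ℝ f q.1 (g q)) (.snd ℝ E F) (x₀, v₀) :=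
    hasFDerivAt_snd.congr_of_eventuallyEq H.split
  have := DFunLike.congr_fun (h2.unique h3) (a, b)
  simp [H.apply_self] at this
  rwa [add_comm] at this

/-- The derivative of the Lagrange condition `D_u e (x, g(x, v)) = λ(x, v) ∘ Df(x)`. -/
theorem fderiv_lagrange (a : E) (b : F) (y : E) :
    fderiv ℝ (fderiv ℝ e) (x₀, u₀) (a, fderiv ℝ g (x₀, v₀) (a, b)) (0, y) =
      fderiv ℝ lam (x₀, v₀) (a, b) (fderiv ℝ f x₀ y)
        + lam (x₀, v₀) (fderiv ℝ (fderiv ℝ f) x₀ a y) := by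
  have h1 : HasFDerivAt (fun q : E × F => fderiv ℝ f q.1)
      ((fderiv ℝ (fderiv ℝ f) x₀).comp (.fst ℝ E F)) (x₀, v₀) :=
    HasFDerivAt.comp (x₀, v₀) (g := fderiv ℝ f) (hasFDerivAt_fderiv H.contDiffAt_proj)
      hasFDerivAt_fst
  have h2 := (H.contDiffAt_multiplier.differentiableAt (by simp)).hasFDerivAt.clm_apply
    (h1.clm_apply (hasFDerivAt_const y _))
  have h4 : HasFDerivAt (fderiv ℝ e) (fderiv ℝ (fderiv ℝ e) (x₀, u₀)) (x₀, g (x₀, v₀)) := by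
    rw [H.apply_self]
    exact hasFDerivAt_fderiv H.contDiffAt_energy
  have h5 : HasFDerivAt (fun q : E × F => fderiv ℝ e (q.1, g q))
      ((fderiv ℝ (fderiv ℝ e) (x₀, u₀)).comp
        ((ContinuousLinearMap.fst ℝ E F).prod (fderiv ℝ g (x₀, v₀)))) (x₀, v₀) :=
    HasFDerivAt.comp (x₀, v₀) (g := fderiv ℝ e) h4 (hasFDerivAt_fst.prodMk H.hasFDerivAt_splitting)
  have h6 := h5.clm_apply (hasFDerivAt_const ((0 : E), y) _)
  have h7 := h6.unique (h2.congr_of_eventuallyEq (H.lagrange.mono fun q hq => hq y))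
  have := DFunLike.congr_fun h7 (a, b)
  simp at this
  rw [this, add_comm]

/-- With `C(y) = ∂ₓe · y - λ(D²f(y, u₀))`, the vector `(u₀, s)` given by the spray equation is
tangent to the graph of `g` if and only if `C` vanishes on `ker (Df)`. -/
theorem exists_fderiv_eq_iff {s : E} (hs : ∀ y, fderiv ℝ (fderiv ℝ e) (x₀, u₀) (u₀, s) (0, y) =
      fderiv ℝ e (x₀, u₀) (y, 0)) :
    (∃ b, fderiv ℝ g (x₀, v₀) (u₀, b) = s) ↔ ∀ y, fderiv ℝ f x₀ y = 0 →
      fderiv ℝ e (x₀, u₀) (y, 0) - lam (x₀, v₀) (fderiv ℝ (fderiv ℝ f) x₀ y u₀) = 0 := by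
  constructor
  · rintro ⟨b, rfl⟩ y hy
    rw [← hs, H.fderiv_lagrange, hy, map_zero, zero_add,
      fderiv_fderiv_symm H.contDiffAt_proj, sub_self]
  · intro hC
    -- The only candidate, by the derivative of `Df(x) g(x, v) = v`.
    let b := fderiv ℝ (fderiv ℝ f) x₀ u₀ u₀ + fderiv ℝ f x₀ s
    refine ⟨b, ?_⟩
    -- The difference is vertical and orthogonal to all vertical vectors.
    set z := s - fderiv ℝ g (x₀, v₀) (u₀, b) with hz
    have hfz : fderiv ℝ f x₀ z = 0 := by
      have := H.fderiv_split u₀ b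
      rw [hz, map_sub, sub_eq_zero]
      exact (add_left_cancel this).symm
    have h0 : ((0 : E), z) = (u₀, s) - (u₀, fderiv ℝ g (x₀, v₀) (u₀, b)) := by simp [hz]
    have hzz : fderiv ℝ (fderiv ℝ e) (x₀, u₀) (0, z) (0, z) = 0 := by
      rw [← congrArg (fun p => fderiv ℝ (fderiv ℝ e) (x₀, u₀) p (0, z)) h0.symm, map_sub,
        sub_apply, hs, H.fderiv_lagrange, hfz, map_zero,
        zero_add, fderiv_fderiv_symm H.contDiffAt_proj]
      exact hC z hfz
    by_contra hne
    exact (H.hessian_pos z (fun h => hne (sub_eq_zero.1 (hz ▸ h)).symm)).ne' hzz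

/-- The derivative of the energy of the splitting in the base variable, the vector `v₀` being kept
fixed. -/
theorem hasFDerivAt_energy_splitting :
    ∃ D : E →L[ℝ] ℝ, HasFDerivAt (fun x => e (x, g (x, v₀))) D x₀ ∧ ∀ y,
      D y = fderiv ℝ e (x₀, u₀) (y, 0) - lam (x₀, v₀) (fderiv ℝ (fderiv ℝ f) x₀ y u₀) := by
  have h1 : HasFDerivAt (fun x => g (x, v₀)) ((fderiv ℝ g (x₀, v₀)).comp (.inl ℝ E F)) x₀ :=
    HasFDerivAt.comp x₀ (g := g) H.hasFDerivAt_splitting (hasFDerivAt_prodMk_left x₀ v₀)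
  have h2 : HasFDerivAt e (fderiv ℝ e (x₀, u₀)) (x₀, g (x₀, v₀)) := by
    rw [H.apply_self]; exact H.hasFDerivAt_energy
  refine ⟨_, HasFDerivAt.comp x₀ (g := e) h2 ((hasFDerivAt_id x₀).prodMk h1), fun y => ?_⟩
  have h3 : (y, fderiv ℝ g (x₀, v₀) (y, 0)) = (y, 0) + (0, fderiv ℝ g (x₀, v₀) (y, 0)) := by simp
  have h4 := H.fderiv_split y 0
  have h5 : fderiv ℝ e (x₀, u₀) (y, fderiv ℝ g (x₀, v₀) (y, 0)) =
      fderiv ℝ e (x₀, u₀) (y, 0) - lam (x₀, v₀) (fderiv ℝ (fderiv ℝ f) x₀ y u₀) := by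
    rw [h3, map_add, H.lagrange_self, eq_neg_of_add_eq_zero_right h4, map_neg, sub_eq_add_neg]
  simpa using h5

/-- The complete lift of a vertical field at a horizontal vector depends only on the value of the
field at the base point. -/
theorem fderiv_energy_completeLift {Y : E → E} (hY : DifferentiableAt ℝ Y x₀)
    (hvert : ∀ᶠ x in 𝓝 x₀, fderiv ℝ f x (Y x) = 0) :
    fderiv ℝ e (x₀, u₀) (Y x₀, fderiv ℝ Y x₀ u₀) =
      fderiv ℝ e (x₀, u₀) (Y x₀, 0) - lam (x₀, v₀) (fderiv ℝ (fderiv ℝ f) x₀ (Y x₀) u₀) := by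
  have h1 := (hasFDerivAt_fderiv H.contDiffAt_proj).clm_apply hY.hasFDerivAt
  have h2 := h1.unique ((hasFDerivAt_const (0 : F) x₀).congr_of_eventuallyEq hvert)
  have h3 := DFunLike.congr_fun h2 u₀
  simp at h3
  have h4 : (Y x₀, fderiv ℝ Y x₀ u₀) = (Y x₀, 0) + (0, fderiv ℝ Y x₀ u₀) := by simp
  rw [h4, map_add, H.lagrange_self, eq_neg_of_add_eq_zero_left h3, map_neg, sub_eq_add_neg,
    fderiv_fderiv_symm H.contDiffAt_proj]

/-- The energy of the splitting has a positive definite fibre Hessian. Its first derivative along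
`w` at `v₀ + t w` is `λ(x₀, v₀ + t w) w` by the Lagrange condition. -/
theorem iteratedDeriv_two_energy_pos {w : F} (hw : w ≠ 0) :
    0 < iteratedDeriv 2 (fun t : ℝ => e (x₀, g (x₀, v₀ + t • w))) 0 := by
  have hl : ∀ t : ℝ, HasDerivAt (fun t : ℝ => v₀ + t • w) w t := fun t => by
    simpa using ((hasDerivAt_id t).smul_const w).const_add v₀
  have hl2 : ∀ t : ℝ, HasDerivAt (fun t : ℝ => (x₀, v₀ + t • w)) (0, w) t := fun t =>
    (hasDerivAt_const t x₀).prodMk (hl t)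
  have hc : Tendsto (fun t : ℝ => (x₀, v₀ + t • w)) (𝓝 0) (𝓝 (x₀, v₀)) := by
    simpa using (hl2 0).continuousAt.tendsto
  have hgdiff : ∀ᶠ q in 𝓝 (x₀, v₀), DifferentiableAt ℝ g q :=
    ((H.contDiffAt_splitting.of_le (m := 1) (WithTop.coe_le_coe.2 le_top)).eventually
      (by simp)).mono fun q hq => hq.differentiableAt (by simp)
  have hediff : ∀ᶠ p in 𝓝 (x₀, u₀), DifferentiableAt ℝ e p :=
    ((H.contDiffAt_energy.of_le (m := 1) (WithTop.coe_le_coe.2 le_top)).eventually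
      (by simp)).mono fun q hq => hq.differentiableAt (by simp)
  have hcg : Tendsto (fun q : E × F => (q.1, g q)) (𝓝 (x₀, v₀)) (𝓝 (x₀, u₀)) := by
    have := continuousAt_fst.prodMk H.contDiffAt_splitting.continuousAt
    simpa [ContinuousAt, H.apply_self] using this
  have key : ∀ᶠ t in 𝓝 (0 : ℝ), deriv (fun t : ℝ => e (x₀, g (x₀, v₀ + t • w))) t
      = lam (x₀, v₀ + t • w) w := by
    filter_upwards [hc.eventually (hgdiff.and ((hcg.eventually hediff).and
      (H.lagrange.and H.split.eventually_nhds)))] with t ht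
    obtain ⟨h1, h2, h3, h4⟩ := ht
    have hg := h1.hasFDerivAt.comp_hasDerivAt t (hl2 t)
    have he := h2.hasFDerivAt.comp_hasDerivAt t ((hasDerivAt_const t x₀).prodMk hg)
    refine he.deriv.trans ?_
    rw [h3]
    congr 1
    have h5 : HasDerivAt (fun t : ℝ => fderiv ℝ f x₀ (g (x₀, v₀ + t • w)))
        (fderiv ℝ f x₀ (fderiv ℝ g (x₀, v₀ + t • w) (0, w))) t :=
      (fderiv ℝ f x₀).hasFDerivAt.comp_hasDerivAt t hg
    refine h5.unique ((hl t).congr_of_eventuallyEq ?_)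
    exact ((hl2 t).continuousAt.tendsto.eventually h4).mono fun r hr => hr
  rw [iteratedDeriv_succ, iteratedDeriv_one, EventuallyEq.deriv_eq key]
  have h1 : HasDerivAt (fun t : ℝ => lam (x₀, v₀ + t • w)) (fderiv ℝ lam (x₀, v₀) (0, w)) 0 :=
    (H.contDiffAt_multiplier.differentiableAt (by simp)).hasFDerivAt.comp_hasDerivAt_of_eq (0 : ℝ)
      (hl2 0) (by simp)
  have h2 : HasDerivAt (fun t : ℝ => lam (x₀, v₀ + t • w) w)
      (fderiv ℝ lam (x₀, v₀) (0, w) w) 0 :=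
    (ContinuousLinearMap.apply ℝ ℝ w).hasFDerivAt.comp_hasDerivAt (0 : ℝ) h1
  rw [h2.deriv]
  have h3 := H.fderiv_split 0 w
  rw [map_zero, zero_apply, zero_add] at h3
  have h4 := H.fderiv_lagrange 0 w (fderiv ℝ g (x₀, v₀) (0, w))
  rw [h3, map_zero, zero_apply, map_zero, add_zero] at h4
  rw [← h4]
  exact H.hessian_pos _ fun h => hw (by rw [← h3, h, map_zero])

end IsLocalSplitting

/-- The spray equation has a solution, as the fibre Hessian is nondegenerate. -/
theorem exists_spray [FiniteDimensional ℝ E] {e : E × E → ℝ} {p : E × E} (a : E)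
    (hpos : ∀ w, w ≠ 0 → 0 < fderiv ℝ (fderiv ℝ e) p (0, w) (0, w)) :
    ∃ s, ∀ y, fderiv ℝ (fderiv ℝ e) p (a, s) (0, y) = fderiv ℝ e p (y, 0) := by
  let T : E →ₗ[ℝ] (E →L[ℝ] ℝ) := (((ContinuousLinearMap.compL ℝ E (E × E) ℝ).flip
    (.inr ℝ E E)).comp ((fderiv ℝ (fderiv ℝ e) p).comp (.inr ℝ E E))).toLinearMap
  have hT : Function.Injective T := by
    rw [injective_iff_map_eq_zero]
    intro s hs
    by_contra hne
    exact (hpos s hne).ne' (DFunLike.congr_fun hs s)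
  have hsurj : Function.Surjective T :=
    (LinearMap.injective_iff_surjective_of_finrank_eq_finrank
      (finrank_strongDual E).symm).1 hT
  obtain ⟨s, hs⟩ := hsurj (((fderiv ℝ e p).comp (.inl ℝ E E)
    - (fderiv ℝ (fderiv ℝ e) p (a, 0)).comp (.inr ℝ E E)))
  refine ⟨s, fun y => ?_⟩
  have h1 : fderiv ℝ (fderiv ℝ e) p (0, s) (0, y) =
      fderiv ℝ e p (y, 0) - fderiv ℝ (fderiv ℝ e) p (a, 0) (0, y) := DFunLike.congr_fun hs y
  have h2 : (a, s) = (a, 0) + (0, s) := by simp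
  rw [h2, map_add, add_apply, h1, add_sub_cancel]

/-- The spray equation in the form `S(Xᵛ(e)) = Xᶜ(e)`. -/
theorem fderiv_vertLift {e : E × E → ℝ} {x₀ u₀ s : E} (he : ContDiffAt ℝ ∞ e (x₀, u₀))
    {X : E → E} (hX : DifferentiableAt ℝ X x₀) :
    HasFDerivAt (fun p : E × E => fderiv ℝ e p (0, X p.1))
      (fderiv ℝ (fun p : E × E => fderiv ℝ e p (0, X p.1)) (x₀, u₀)) (x₀, u₀) ∧
    fderiv ℝ (fun p : E × E => fderiv ℝ e p (0, X p.1)) (x₀, u₀) (u₀, s)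
      - fderiv ℝ e (x₀, u₀) (X x₀, fderiv ℝ X x₀ u₀) =
    fderiv ℝ (fderiv ℝ e) (x₀, u₀) (u₀, s) (0, X x₀) - fderiv ℝ e (x₀, u₀) (X x₀, 0) := by
  have h1 : HasFDerivAt (fun p : E × E => X p.1) ((fderiv ℝ X x₀).comp (.fst ℝ E E)) (x₀, u₀) :=
    HasFDerivAt.comp (x₀, u₀) (g := X) hX.hasFDerivAt hasFDerivAt_fst
  have h2 := (hasFDerivAt_fderiv he).clm_apply ((hasFDerivAt_const (0 : E) (x₀, u₀)).prodMk h1)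
  refine ⟨h2.differentiableAt.hasFDerivAt, ?_⟩
  rw [h2.fderiv]
  have h3 : (X x₀, fderiv ℝ X x₀ u₀) = (X x₀, 0) + (0, fderiv ℝ X x₀ u₀) := by simp
  rw [h3, map_add]
  simp
  ring

end LocalCalculus

/-! ### Charts of the tangent bundle -/

section TangentCharts

variable {E : Type*} [NormedAddCommGroup E] [NormedSpace ℝ E]
  {M : Type*} [TopologicalSpace M] [ChartedSpace E M] [IsManifold 𝓘(ℝ, E) ∞ M]

/-- The inverse of the fibre coordinate of the chart of `TM` induced by the preferred chart of `M`
at `m₀`, over the point with coordinate `x`. -/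
def fibreSymm (E : Type*) [NormedAddCommGroup E] [NormedSpace ℝ E] {M : Type*}
    [TopologicalSpace M] [ChartedSpace E M] [IsManifold 𝓘(ℝ, E) ∞ M] (m₀ : M) (x : E) : E →L[ℝ] E :=
  (trivializationAt E (TangentSpace 𝓘(ℝ, E) : M → Type _) m₀).symmL ℝ
    ((extChartAt 𝓘(ℝ, E) m₀).symm x)

/-- The inverse of the chart of `TM` induced by the preferred chart of `M` at `m₀`. It is defined
through the linear maps `symmL`, so that it is linear in the fibre coordinate everywhere. -/
def tangentChartSymm (E : Type*) [NormedAddCommGroup E] [NormedSpace ℝ E] {M : Type*}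
    [TopologicalSpace M] [ChartedSpace E M] [IsManifold 𝓘(ℝ, E) ∞ M] (m₀ : M) (q : E × E) :
    TangentBundle 𝓘(ℝ, E) M :=
  ⟨(extChartAt 𝓘(ℝ, E) m₀).symm q.1, fibreSymm E m₀ q.1 q.2⟩

/-- The fibre coordinate of a tangent vector in the chart of `TM` induced by the preferred chart of
`M` at `m₀`. -/
def fibreCoord (E : Type*) [NormedAddCommGroup E] [NormedSpace ℝ E] {M : Type*}
    [TopologicalSpace M] [ChartedSpace E M] [IsManifold 𝓘(ℝ, E) ∞ M] (m₀ : M)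
    (w : TangentBundle 𝓘(ℝ, E) M) : E :=
  (trivializationAt E (TangentSpace 𝓘(ℝ, E) : M → Type _) m₀).continuousLinearMapAt ℝ w.proj w.2

theorem fibreCoord_eq_mfderiv {m₀ m : M} (hm : m ∈ (chartAt E m₀).source)
    (u : TangentSpace 𝓘(ℝ, E) m) :
    fibreCoord E m₀ ⟨m, u⟩ = mfderiv 𝓘(ℝ, E) 𝓘(ℝ, E) (extChartAt 𝓘(ℝ, E) m₀) m u := by
  rw [fibreCoord, TangentBundle.continuousLinearMapAt_trivializationAt hm]
  rfl

/-- Over the domain of the chart, `fibreCoord` is the fibre component of the trivialization. -/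
theorem fibreCoord_eq_snd {m₀ : M} {w : TangentBundle 𝓘(ℝ, E) M}
    (hm : w.proj ∈ (chartAt E m₀).source) :
    fibreCoord E m₀ w = (trivializationAt E (TangentSpace 𝓘(ℝ, E) : M → Type _) m₀ w).2 := by
  rw [fibreCoord, Bundle.Trivialization.continuousLinearMapAt_apply,
    Bundle.Trivialization.linearMapAt_apply, if_pos (by simpa using hm)]

theorem fibreCoord_self (m : M) (u : E) :
    fibreCoord E m (⟨m, u⟩ : TangentBundle 𝓘(ℝ, E) M) = u :=
  (fibreCoord_eq_mfderiv (mem_chart_source E m) u).trans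
    (DFunLike.congr_fun (mfderiv_extChartAt_self (I := 𝓘(ℝ, E)) (x := m)) u)

theorem fibreCoord_add_smul (m₀ m : M) (u w : TangentSpace 𝓘(ℝ, E) m) (t : ℝ) :
    fibreCoord E m₀ ⟨m, u + t • w⟩ = fibreCoord E m₀ ⟨m, u⟩ + t • fibreCoord E m₀ ⟨m, w⟩ := by
  simp [fibreCoord]

theorem tangentChartSymm_add_smul (m₀ : M) (x u y : E) (t : ℝ) :
    tangentChartSymm E m₀ (x, u + t • y) =
      ⟨(extChartAt 𝓘(ℝ, E) m₀).symm x, fibreSymm E m₀ x u + t • fibreSymm E m₀ x y⟩ := by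
  simp only [tangentChartSymm, map_add, map_smul]

theorem tangentChartSymm_fibreCoord {m₀ : M} {w : TangentBundle 𝓘(ℝ, E) M}
    (hm : w.proj ∈ (chartAt E m₀).source) :
    tangentChartSymm E m₀ (extChartAt 𝓘(ℝ, E) m₀ w.proj, fibreCoord E m₀ w) = w := by
  obtain ⟨m, u⟩ := w
  have h : (extChartAt 𝓘(ℝ, E) m₀).symm (extChartAt 𝓘(ℝ, E) m₀ m) = m :=
    (extChartAt 𝓘(ℝ, E) m₀).left_inv (by simpa using hm)
  simp only [tangentChartSymm, fibreCoord, fibreSymm]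
  rw [h]
  exact congrArg (TotalSpace.mk m) (Bundle.Trivialization.symmL_continuousLinearMapAt
    (trivializationAt E (TangentSpace 𝓘(ℝ, E) : M → Type _) m₀) (by simpa using hm) u)

omit [IsManifold 𝓘(ℝ, E) ∞ M] in
theorem symm_mem_chart_source {m₀ : M} {x : E} (hx : x ∈ (extChartAt 𝓘(ℝ, E) m₀).target) :
    (extChartAt 𝓘(ℝ, E) m₀).symm x ∈ (chartAt E m₀).source := by
  simpa using (extChartAt 𝓘(ℝ, E) m₀).map_target hx

theorem fibreCoord_tangentChartSymm {m₀ : M} {x : E} (u : E)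
    (hx : x ∈ (extChartAt 𝓘(ℝ, E) m₀).target) :
    fibreCoord E m₀ (tangentChartSymm E m₀ (x, u)) = u := by
  exact Bundle.Trivialization.continuousLinearMapAt_symmL
    (trivializationAt E (TangentSpace 𝓘(ℝ, E) : M → Type _) m₀)
    (b := (extChartAt 𝓘(ℝ, E) m₀).symm x) (by simpa using symm_mem_chart_source hx) u

@[simp]
theorem tangentChartSymm_self (m : M) (u : E) :
    tangentChartSymm E m (extChartAt 𝓘(ℝ, E) m m, u) =
      (⟨m, u⟩ : TangentBundle 𝓘(ℝ, E) M) := by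
  have := tangentChartSymm_fibreCoord (E := E) (m₀ := m)
    (w := (⟨m, u⟩ : TangentBundle 𝓘(ℝ, E) M)) (mem_chart_source E m)
  exact (congrArg (fun y => tangentChartSymm E m (extChartAt 𝓘(ℝ, E) m m, y))
    (fibreCoord_self m u)).symm.trans this

/-- The preferred chart of `TM` at `u` depends on the base point of `u` only. -/
theorem extChartAt_tangent_apply {u w : TangentBundle 𝓘(ℝ, E) M}
    (hw : w.proj ∈ (chartAt E u.proj).source) :
    extChartAt 𝓘(ℝ, E).tangent u w =
      (extChartAt 𝓘(ℝ, E) u.proj w.proj, fibreCoord E u.proj w) := by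
  rw [fibreCoord_eq_snd hw, ModelWithCorners.tangent]
  erw [FiberBundle.extChartAt]
  have h : (trivializationAt E (TangentSpace 𝓘(ℝ, E) : M → Type _) u.proj w).1 = w.proj :=
    Bundle.Trivialization.coe_fst' _ (by simpa using hw)
  refine Prod.ext ?_ rfl
  exact congrArg (extChartAt 𝓘(ℝ, E) u.proj) h

theorem extChartAt_tangent_symm_apply (u : TangentBundle 𝓘(ℝ, E) M) {q : E × E}
    (hq : q.1 ∈ (extChartAt 𝓘(ℝ, E) u.proj).target) :
    (extChartAt 𝓘(ℝ, E).tangent u).symm q = tangentChartSymm E u.proj q := by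
  have hs : (tangentChartSymm E u.proj q).proj ∈ (chartAt E u.proj).source :=
    symm_mem_chart_source hq
  have h1 : extChartAt 𝓘(ℝ, E).tangent u (tangentChartSymm E u.proj q) = q := by
    rw [extChartAt_tangent_apply hs, fibreCoord_tangentChartSymm q.2 hq]
    exact Prod.ext ((extChartAt 𝓘(ℝ, E) u.proj).right_inv hq) rfl
  have h2 : tangentChartSymm E u.proj q ∈ (extChartAt 𝓘(ℝ, E).tangent u).source := by
    rw [extChartAt_source]
    exact (TangentBundle.mem_chart_source_iff _ _).2 hs
  conv_lhs => rw [← h1]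
  exact (extChartAt 𝓘(ℝ, E).tangent u).left_inv h2

theorem extChartAt_tangent_symm_eventuallyEq (u : TangentBundle 𝓘(ℝ, E) M) (v : E) :
    (extChartAt 𝓘(ℝ, E).tangent u).symm
      =ᶠ[𝓝 (extChartAt 𝓘(ℝ, E) u.proj u.proj, v)] tangentChartSymm E u.proj := by
  have h : ∀ᶠ q : E × E in 𝓝 (extChartAt 𝓘(ℝ, E) u.proj u.proj, v),
      q.1 ∈ (extChartAt 𝓘(ℝ, E) u.proj).target :=
    (continuous_fst.tendsto (extChartAt 𝓘(ℝ, E) u.proj u.proj, v)).eventually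
      (extChartAt_target_mem_nhds (I := 𝓘(ℝ, E)) u.proj)
  filter_upwards [h] with q hq using extChartAt_tangent_symm_apply u hq

theorem extChartAt_tangent_self (m : M) (u : E) :
    extChartAt 𝓘(ℝ, E).tangent (⟨m, u⟩ : TangentBundle 𝓘(ℝ, E) M) ⟨m, u⟩ =
      (extChartAt 𝓘(ℝ, E) m m, u) := by
  rw [extChartAt_tangent_apply (mem_chart_source E m)]
  exact congrArg (Prod.mk _) (fibreCoord_self m u)

theorem contDiffAt_comp_tangentChartSymm {f : TangentBundle 𝓘(ℝ, E) M → ℝ} {m : M} {u : E}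
    (hf : ContMDiffAt 𝓘(ℝ, E).tangent 𝓘(ℝ, ℝ) ∞ f ⟨m, u⟩) :
    ContDiffAt ℝ ∞ (f ∘ tangentChartSymm E m) (extChartAt 𝓘(ℝ, E) m m, u) := by
  have h := (contMDiffAt_iff.1 hf).2
  rw [ModelWithCorners.Boundaryless.range_eq_univ, contDiffWithinAt_univ,
    extChartAt_tangent_self] at h
  refine h.congr_of_eventuallyEq ?_
  filter_upwards [extChartAt_tangent_symm_eventuallyEq (⟨m, u⟩ : TangentBundle 𝓘(ℝ, E) M) u]
    with q hq
  exact congrArg f hq.symm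

theorem hasMFDerivAt_of_tangentChartSymm {f : TangentBundle 𝓘(ℝ, E) M → ℝ} {m : M} {u : E}
    {D : E × E →L[ℝ] ℝ}
    (hf : HasFDerivAt (f ∘ tangentChartSymm E m) D (extChartAt 𝓘(ℝ, E) m m, u)) :
    HasMFDerivAt 𝓘(ℝ, E).tangent 𝓘(ℝ, ℝ) f ⟨m, u⟩ D := by
  have hev := extChartAt_tangent_symm_eventuallyEq (⟨m, u⟩ : TangentBundle 𝓘(ℝ, E) M) u
  have h1 : HasFDerivAt (f ∘ (extChartAt 𝓘(ℝ, E).tangent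
      (⟨m, u⟩ : TangentBundle 𝓘(ℝ, E) M)).symm) D (extChartAt 𝓘(ℝ, E) m m, u) := by
    refine hf.congr_of_eventuallyEq ?_
    filter_upwards [hev] with q hq
    exact congrArg f hq
  rw [← extChartAt_tangent_self (M := M)] at h1
  refine ⟨?_, ?_⟩
  · have h2 := ContinuousAt.comp (f := extChartAt 𝓘(ℝ, E).tangent
      (⟨m, u⟩ : TangentBundle 𝓘(ℝ, E) M)) h1.continuousAt
        (continuousAt_extChartAt (I := 𝓘(ℝ, E).tangent) (⟨m, u⟩ : TangentBundle 𝓘(ℝ, E) M))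
    refine h2.congr ?_
    filter_upwards [extChartAt_source_mem_nhds (I := 𝓘(ℝ, E).tangent)
      (⟨m, u⟩ : TangentBundle 𝓘(ℝ, E) M)] with w hw
    exact congrArg f ((extChartAt 𝓘(ℝ, E).tangent
      (⟨m, u⟩ : TangentBundle 𝓘(ℝ, E) M)).left_inv hw)
  · exact h1.hasFDerivWithinAt

/-- Tangent vectors of `TM` at `(m, u)` are read in the chart over `m`, so that the derivative along
such a vector is the derivative of the coordinate expression. -/
theorem dirDeriv_eq_fderiv {f : TangentBundle 𝓘(ℝ, E) M → ℝ} {m : M} {u : E}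
    (hf : DifferentiableAt ℝ (f ∘ tangentChartSymm E m) (extChartAt 𝓘(ℝ, E) m m, u))
    (s : E × E) : dirDeriv f ⟨m, u⟩ s =
      fderiv ℝ (f ∘ tangentChartSymm E m) (extChartAt 𝓘(ℝ, E) m m, u) s := by
  exact DFunLike.congr_fun (hasMFDerivAt_of_tangentChartSymm hf.hasFDerivAt).mfderiv s

/-- The vector field `X` in the preferred chart at `m₀`. -/
def localField (m₀ : M) (X : (m : M) → TangentSpace 𝓘(ℝ, E) m) (x : E) : E :=
  fibreCoord E m₀ ⟨(extChartAt 𝓘(ℝ, E) m₀).symm x, X ((extChartAt 𝓘(ℝ, E) m₀).symm x)⟩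

theorem localField_self (m : M) (X : (m : M) → TangentSpace 𝓘(ℝ, E) m) :
    localField m X (extChartAt 𝓘(ℝ, E) m m) = X m := by
  unfold localField
  rw [extChartAt_to_inv]
  exact fibreCoord_self (E := E) m (X m)

theorem localField_spec {m₀ : M} {X : (m : M) → TangentSpace 𝓘(ℝ, E) m} {x : E}
    (hx : x ∈ (extChartAt 𝓘(ℝ, E) m₀).target) :
    fibreSymm E m₀ x (localField m₀ X x) = X ((extChartAt 𝓘(ℝ, E) m₀).symm x) :=
  Bundle.Trivialization.symmL_continuousLinearMapAt
    (trivializationAt E (TangentSpace 𝓘(ℝ, E) : M → Type _) m₀)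
    (by simpa using symm_mem_chart_source hx) _

/-- In charts, `Xᵛ(f)` is the partial derivative `∂ᵤf · X(x)`. -/
theorem vertLift_tangentChartSymm (f : TangentBundle 𝓘(ℝ, E) M → ℝ) {m₀ : M}
    (X : (m : M) → TangentSpace 𝓘(ℝ, E) m) {q : E × E}
    (hq : q.1 ∈ (extChartAt 𝓘(ℝ, E) m₀).target)
    (hf : DifferentiableAt ℝ (f ∘ tangentChartSymm E m₀) q) :
    vertLift X f (tangentChartSymm E m₀ q) =
      fderiv ℝ (f ∘ tangentChartSymm E m₀) q (0, localField m₀ X q.1) := by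
  have hl : HasDerivAt (fun t : ℝ => (q.1, q.2 + t • localField m₀ X q.1))
      (0, localField m₀ X q.1) 0 := by
    refine (hasDerivAt_const (0 : ℝ) q.1).prodMk ?_
    simpa using ((hasDerivAt_id (0 : ℝ)).smul_const (localField m₀ X q.1)).const_add q.2
  have h := hf.hasFDerivAt.comp_hasDerivAt_of_eq (0 : ℝ) hl (by simp)
  rw [← h.deriv, vertLift]
  congr 1
  ext t
  simp only [Function.comp]
  rw [tangentChartSymm_add_smul, localField_spec hq]
  rfl

theorem contDiffAt_localField {X : (m : M) → TangentSpace 𝓘(ℝ, E) m} (hX : IsSmoothField X)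
    (m : M) : ContDiffAt ℝ ∞ (localField m X) (extChartAt 𝓘(ℝ, E) m m) := by
  have h1 := (Bundle.contMDiffAt_totalSpace.1 (hX m)).2
  have h2 := (contMDiffAt_iff.1 h1).2
  rw [ModelWithCorners.Boundaryless.range_eq_univ, contDiffWithinAt_univ] at h2
  refine h2.congr_of_eventuallyEq ?_
  filter_upwards [extChartAt_target_mem_nhds (I := 𝓘(ℝ, E)) m] with x hx
  exact fibreCoord_eq_snd (symm_mem_chart_source hx)

/-- In charts, the complete lift at `(x, u)` is the vector `(X(x), DX(x) u)`. -/
theorem completeLiftVec_eq {X : (m : M) → TangentSpace 𝓘(ℝ, E) m} (hX : IsSmoothField X) (m : M)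
    (u : E) : completeLiftVec X ⟨m, u⟩ =
      ((localField m X (extChartAt 𝓘(ℝ, E) m m),
        fderiv ℝ (localField m X) (extChartAt 𝓘(ℝ, E) m m) u) : E × E) := by
  have hd := (contDiffAt_localField hX m).differentiableAt (by simp)
  have h1 : HasMFDerivAt 𝓘(ℝ, E) 𝓘(ℝ, E).tangent
      (fun m => (⟨m, X m⟩ : TangentBundle 𝓘(ℝ, E) M)) m
      ((ContinuousLinearMap.id ℝ E).prod
        (fderiv ℝ (localField m X) (extChartAt 𝓘(ℝ, E) m m))) := by
    refine ⟨(hX m).continuousAt, ?_⟩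
    have h2 := (hasFDerivAt_id (𝕜 := ℝ) (extChartAt 𝓘(ℝ, E) m m)).prodMk hd.hasFDerivAt
    refine (h2.congr_of_eventuallyEq ?_).hasFDerivWithinAt
    filter_upwards [extChartAt_target_mem_nhds (I := 𝓘(ℝ, E)) m] with x hx
    simp only [writtenInExtChartAt, Function.comp]
    rw [extChartAt_tangent_apply (symm_mem_chart_source hx)]
    exact Prod.ext ((extChartAt 𝓘(ℝ, E) m).right_inv hx) rfl
  unfold completeLiftVec
  rw [h1.mfderiv, localField_self]
  rfl

end TangentCharts

/-! ### The energy of a Finsler function -/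

section FibreEnergy

variable {E : Type*} [NormedAddCommGroup E] [NormedSpace ℝ E]
  {M : Type*} [TopologicalSpace M] [ChartedSpace E M] [IsManifold 𝓘(ℝ, E) ∞ M]

theorem tendsto_fibreCoord (w : TangentBundle 𝓘(ℝ, E) M) :
    Tendsto (fibreCoord E w.proj) (𝓝 w) (𝓝 w.2) := by
  have h := ((trivializationAt E (TangentSpace 𝓘(ℝ, E) : M → Type _) w.proj).continuousAt
    (FiberBundle.mem_trivializationAt_proj_source (E := (TangentSpace 𝓘(ℝ, E) : M → Type _))
      (x := w))).snd.tendsto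
  have h1 : (trivializationAt E (TangentSpace 𝓘(ℝ, E) : M → Type _) w.proj w).2 = w.2 :=
    (fibreCoord_eq_snd (mem_chart_source E w.proj)).symm.trans (fibreCoord_self (E := E) w.proj w.2)
  erw [h1] at h
  refine h.congr' ?_
  filter_upwards [(FiberBundle.continuous_proj E (TangentSpace 𝓘(ℝ, E) : M → Type _)).continuousAt
    ((chartAt E w.proj).open_source.mem_nhds (mem_chart_source E w.proj))] with w' hw'
  exact (fibreCoord_eq_snd hw').symm

theorem fibreCoord_injOn {m₀ m : M} (hm : m ∈ (chartAt E m₀).source) {u u' : E}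
    (h : fibreCoord E m₀ (⟨m, u⟩ : TangentBundle 𝓘(ℝ, E) M) = fibreCoord E m₀ ⟨m, u'⟩) :
    u = u' := by
  have h1 := tangentChartSymm_fibreCoord (E := E) (m₀ := m₀)
    (w := (⟨m, u⟩ : TangentBundle 𝓘(ℝ, E) M)) hm
  have h2 := tangentChartSymm_fibreCoord (E := E) (m₀ := m₀)
    (w := (⟨m, u'⟩ : TangentBundle 𝓘(ℝ, E) M)) hm
  rw [h] at h1
  have h3 := h1.symm.trans h2
  exact eq_of_heq (TotalSpace.mk.inj h3).2

theorem fibreCoord_zero (m₀ m : M) :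
    fibreCoord E m₀ (⟨m, (0 : E)⟩ : TangentBundle 𝓘(ℝ, E) M) = 0 :=
  map_zero ((trivializationAt E (TangentSpace 𝓘(ℝ, E) : M → Type _) m₀).continuousLinearMapAt ℝ m)

theorem isOpen_slitTangent : IsOpen (slitTangent E M) := by
  refine isOpen_iff_mem_nhds.2 fun w hw => ?_
  filter_upwards [(tendsto_fibreCoord w).eventually (isOpen_ne.mem_nhds hw)] with w' hw' h0
  refine hw' ?_
  obtain ⟨m, u⟩ := w'
  change u = 0 at h0
  subst h0
  exact fibreCoord_zero _ _

variable {F : TangentBundle 𝓘(ℝ, E) M → ℝ} (hF : IsFinsler F)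
include hF

theorem IsFinsler.contMDiffAt_energy {m : M} {u : E} (hu : u ≠ 0) :
    ContMDiffAt 𝓘(ℝ, E).tangent 𝓘(ℝ, ℝ) ∞ (energy F) (⟨m, u⟩ : TangentBundle 𝓘(ℝ, E) M) := by
  have h : ContMDiffAt 𝓘(ℝ, E).tangent 𝓘(ℝ, ℝ) ∞ F ⟨m, u⟩ :=
    hF.smooth.contMDiffAt (isOpen_slitTangent.mem_nhds hu)
  have hs : ContDiff ℝ ∞ fun x : ℝ => (1 / 2) * x ^ 2 := by fun_prop
  exact hs.contMDiff.contMDiffAt.comp _ h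

theorem IsFinsler.contDiffAt_energy {m : M} {u : E} (hu : u ≠ 0) :
    ContDiffAt ℝ ∞ (energy F ∘ tangentChartSymm E m) (extChartAt 𝓘(ℝ, E) m m, u) :=
  contDiffAt_comp_tangentChartSymm (hF.contMDiffAt_energy hu)

theorem IsFinsler.isMinkowskiEnergy (m : M) :
    IsMinkowskiEnergy fun u : E => energy F (⟨m, u⟩ : TangentBundle 𝓘(ℝ, E) M) := by
  have hsm : ∀ u : E, u ≠ 0 →
      ContDiffAt ℝ ∞ (fun u : E => energy F (⟨m, u⟩ : TangentBundle 𝓘(ℝ, E) M)) u := by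
    intro u hu
    have h := ContDiffAt.comp u (hF.contDiffAt_energy (m := m) hu)
      (contDiffAt_const.prodMk contDiffAt_id)
    refine h.congr_of_eventuallyEq (Eventually.of_forall fun u' => ?_)
    exact congrArg (energy F) (tangentChartSymm_self m u').symm
  refine ⟨fun u => ?_, ?_, fun u c hc => ?_, hsm, fun u w hu hw => ?_⟩
  · unfold energy; positivity
  · have h1 : Continuous fun u : E => F (⟨m, u⟩ : TangentBundle 𝓘(ℝ, E) M) :=
      hF.continuous.comp (FiberBundle.continuous_totalSpaceMk E
        (TangentSpace 𝓘(ℝ, E) : M → Type _) m)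
    exact continuous_const.mul (h1.pow 2)
  · have h := hF.homogeneous m u c hc
    change (1 / 2) * F ⟨m, c • u⟩ ^ 2 = c ^ 2 * ((1 / 2) * F ⟨m, u⟩ ^ 2)
    have h' : F (⟨m, c • u⟩ : TangentBundle 𝓘(ℝ, E) M) = c * F ⟨m, u⟩ := h
    rw [h']
    ring
  · rw [← iteratedDeriv_two_line ((hsm u hu).of_le (WithTop.coe_le_coe.2 le_top))]
    exact hF.stronglyConvex m u w hu hw

/-- Strong convexity as a condition on the Hessian of the coordinate expression of the energy. -/
theorem IsFinsler.hessian_energy_pos {m : M} {u w : E} (hu : u ≠ 0) (hw : w ≠ 0) :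
    0 < fderiv ℝ (fderiv ℝ (energy F ∘ tangentChartSymm E m))
      (extChartAt 𝓘(ℝ, E) m m, u) (0, w) (0, w) := by
  rw [← iteratedDeriv_two_line ((hF.contDiffAt_energy hu).of_le (WithTop.coe_le_coe.2 le_top))]
  have h := hF.stronglyConvex m u w hu hw
  have h1 : (fun t : ℝ => (energy F ∘ tangentChartSymm E m)
      ((extChartAt 𝓘(ℝ, E) m m, u) + t • ((0 : E), w))) =
      fun t : ℝ => energy F (⟨m, u + t • w⟩ : TangentBundle 𝓘(ℝ, E) M) := by
    ext t
    simp only [Function.comp, Prod.smul_mk, smul_zero, Prod.mk_add_mk, add_zero]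
    exact congrArg (energy F) (tangentChartSymm_self m (u + t • w))
  rw [h1]
  exact h

theorem IsFinsler.map_zero (m : M) : F (⟨m, (0 : E)⟩ : TangentBundle 𝓘(ℝ, E) M) = 0 := by
  have h := (hF.isMinkowskiEnergy m).map_zero
  simpa [energy] using h

theorem IsFinsler.energy_le_iff (w w' : TangentBundle 𝓘(ℝ, E) M) :
    energy F w ≤ energy F w' ↔ F w ≤ F w' := by
  unfold energy
  rw [mul_le_mul_iff_right₀ (by norm_num), sq_le_sq₀ (hF.nonneg w) (hF.nonneg w')]

end FibreEnergy

/-! ### The projection in charts and the pullback bundle -/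

section Projection

variable {EM : Type*} [NormedAddCommGroup EM] [NormedSpace ℝ EM]
  {M : Type*} [TopologicalSpace M] [ChartedSpace EM M] [IsManifold 𝓘(ℝ, EM) ∞ M]
  {EN : Type*} [NormedAddCommGroup EN] [NormedSpace ℝ EN]
  {N : Type*} [TopologicalSpace N] [ChartedSpace EN N] [IsManifold 𝓘(ℝ, EN) ∞ N]
  (π : C^∞⟮𝓘(ℝ, EM), M; 𝓘(ℝ, EN), N⟯)

/-- The map `π` in the preferred charts at `m₀` and `π m₀`. -/
def localMap (m₀ : M) (x : EM) : EN :=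
  extChartAt 𝓘(ℝ, EN) (π m₀) (π ((extChartAt 𝓘(ℝ, EM) m₀).symm x))

/-- The differential of `π` as a linear map of the model spaces. -/
def projDeriv (m : M) : EM →L[ℝ] EN := mfderiv 𝓘(ℝ, EM) 𝓘(ℝ, EN) π m

theorem contDiffAt_localMap {m₀ m : M} (hm : m ∈ (chartAt EM m₀).source)
    (hn : π m ∈ (chartAt EN (π m₀)).source) :
    ContDiffAt ℝ ∞ (localMap π m₀) (extChartAt 𝓘(ℝ, EM) m₀ m) := by
  have hx : extChartAt 𝓘(ℝ, EM) m₀ m ∈ (extChartAt 𝓘(ℝ, EM) m₀).target :=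
    (extChartAt 𝓘(ℝ, EM) m₀).map_source (by simpa using hm)
  have hinv : (extChartAt 𝓘(ℝ, EM) m₀).symm (extChartAt 𝓘(ℝ, EM) m₀ m) = m :=
    (extChartAt 𝓘(ℝ, EM) m₀).left_inv (by simpa using hm)
  have h1 : ContMDiffAt 𝓘(ℝ, EM) 𝓘(ℝ, EN) ∞ (fun m => extChartAt 𝓘(ℝ, EN) (π m₀) (π m)) m :=
    (contMDiffAt_extChartAt' hn).comp m π.contMDiff.contMDiffAt
  have h2 : ContMDiffAt 𝓘(ℝ, EM) 𝓘(ℝ, EM) ∞ (extChartAt 𝓘(ℝ, EM) m₀).symm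
      (extChartAt 𝓘(ℝ, EM) m₀ m) :=
    (contMDiffOn_extChartAt_symm m₀).contMDiffAt ((isOpen_extChartAt_target m₀).mem_nhds hx)
  rw [← hinv] at h1
  exact (h1.comp (extChartAt 𝓘(ℝ, EM) m₀ m) h2).contDiffAt

/-- The differential of `π` in charts. -/
theorem fibreCoord_projDeriv {m₀ m : M} (hm : m ∈ (chartAt EM m₀).source)
    (hn : π m ∈ (chartAt EN (π m₀)).source) (u : EM) :
    fibreCoord EN (π m₀) (⟨π m, projDeriv π m u⟩ : TangentBundle 𝓘(ℝ, EN) N) =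
      fderiv ℝ (localMap π m₀) (extChartAt 𝓘(ℝ, EM) m₀ m)
        (fibreCoord EM m₀ (⟨m, u⟩ : TangentBundle 𝓘(ℝ, EM) M)) := by
  have hx : extChartAt 𝓘(ℝ, EM) m₀ m ∈ (extChartAt 𝓘(ℝ, EM) m₀).target :=
    (extChartAt 𝓘(ℝ, EM) m₀).map_source (by simpa using hm)
  have hinv : (extChartAt 𝓘(ℝ, EM) m₀).symm (extChartAt 𝓘(ℝ, EM) m₀ m) = m :=
    (extChartAt 𝓘(ℝ, EM) m₀).left_inv (by simpa using hm)
  have hπ : MDifferentiableAt 𝓘(ℝ, EM) 𝓘(ℝ, EN) π m := π.contMDiff.mdifferentiable (by simp) m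
  have hφ : MDifferentiableAt 𝓘(ℝ, EM) 𝓘(ℝ, EM) (extChartAt 𝓘(ℝ, EM) m₀) m :=
    mdifferentiableAt_extChartAt hm
  have hφN : MDifferentiableAt 𝓘(ℝ, EN) 𝓘(ℝ, EN) (extChartAt 𝓘(ℝ, EN) (π m₀)) (π m) :=
    mdifferentiableAt_extChartAt hn
  have hsymm : MDifferentiableAt 𝓘(ℝ, EM) 𝓘(ℝ, EM) (extChartAt 𝓘(ℝ, EM) m₀).symm
      (extChartAt 𝓘(ℝ, EM) m₀ m) := by
    have := mdifferentiableWithinAt_extChartAt_symm (I := 𝓘(ℝ, EM)) hx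
    rwa [ModelWithCorners.Boundaryless.range_eq_univ, mdifferentiableWithinAt_univ] at this
  have hf : MDifferentiableAt 𝓘(ℝ, EM) 𝓘(ℝ, EN) (localMap π m₀) (extChartAt 𝓘(ℝ, EM) m₀ m) := by
    have h1 : MDifferentiableAt 𝓘(ℝ, EM) 𝓘(ℝ, EN) (fun m => extChartAt 𝓘(ℝ, EN) (π m₀) (π m)) m :=
      hφN.comp m hπ
    rw [← hinv] at h1
    exact h1.comp (extChartAt 𝓘(ℝ, EM) m₀ m) hsymm
  have hev : (fun m => localMap π m₀ (extChartAt 𝓘(ℝ, EM) m₀ m)) =ᶠ[𝓝 m]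
      fun m => extChartAt 𝓘(ℝ, EN) (π m₀) (π m) := by
    filter_upwards [(chartAt EM m₀).open_source.mem_nhds hm] with m' hm'
    unfold localMap
    rw [(extChartAt 𝓘(ℝ, EM) m₀).left_inv (by simpa using hm')]
  have h1 := hf.hasMFDerivAt.comp m hφ.hasMFDerivAt
  have h2 := hφN.hasMFDerivAt.comp m hπ.hasMFDerivAt
  have h3 := hasMFDerivAt_unique (h2.congr_of_eventuallyEq hev) h1
  rw [mfderiv_eq_fderiv] at h3
  refine (fibreCoord_eq_mfderiv hn _).trans ?_
  refine Eq.trans ?_ (congrArg _ (fibreCoord_eq_mfderiv hm u).symm)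
  exact DFunLike.congr_fun h3 u

theorem fderiv_localMap_self (m : M) :
    fderiv ℝ (localMap π m) (extChartAt 𝓘(ℝ, EM) m m) = projDeriv π m := by
  ext u
  have h := fibreCoord_projDeriv π (mem_chart_source EM m) (mem_chart_source EN (π m)) u
  rw [fibreCoord_self, fibreCoord_self] at h
  exact h.symm

omit [IsManifold 𝓘(ℝ, EM) ∞ M] [IsManifold 𝓘(ℝ, EN) ∞ N] in
theorem eventually_mem_chart_source (m₀ : M) :
    ∀ᶠ m in 𝓝 m₀, m ∈ (chartAt EM m₀).source ∧ π m ∈ (chartAt EN (π m₀)).source :=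
  ((chartAt EM m₀).open_source.eventually_mem (mem_chart_source EM m₀)).and
    (π.contMDiff.continuous.continuousAt
      ((chartAt EN (π m₀)).open_source.mem_nhds (mem_chart_source EN (π m₀))))

omit [IsManifold 𝓘(ℝ, EM) ∞ M] in
/-- A map into `π^*TN` is smooth if and only if its components in `M` and in `TN` are. -/
theorem contMDiffAt_pullback_iff {EX : Type*} [NormedAddCommGroup EX] [NormedSpace ℝ EX]
    {HX : Type*} [TopologicalSpace HX] {I : ModelWithCorners ℝ EX HX}
    {X : Type*} [TopologicalSpace X] [ChartedSpace HX X] {G : X → PullbackTangent π} {x : X} :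
    ContMDiffAt I (𝓘(ℝ, EM).prod 𝓘(ℝ, EN)) ∞ G x ↔
      ContMDiffAt I 𝓘(ℝ, EM) ∞ (fun x => (G x).proj) x ∧
      ContMDiffAt I 𝓘(ℝ, EN).tangent ∞ (fun x => pullbackToTN π (G x)) x := by
  rw [Bundle.contMDiffAt_totalSpace, ModelWithCorners.tangent]
  erw [Bundle.contMDiffAt_totalSpace]
  constructor
  · rintro ⟨h1, h2⟩
    exact ⟨h1, π.contMDiff.contMDiffAt.comp x h1, h2⟩
  · rintro ⟨h1, h2, h3⟩
    exact ⟨h1, h3⟩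

omit [IsManifold 𝓘(ℝ, EM) ∞ M] in
theorem contMDiff_pullbackToTN :
    ContMDiff (𝓘(ℝ, EM).prod 𝓘(ℝ, EN)) 𝓘(ℝ, EN).tangent ∞ (pullbackToTN π) := fun p =>
  ((contMDiffAt_pullback_iff π).1 (contMDiffAt_id (I := 𝓘(ℝ, EM).prod 𝓘(ℝ, EN)) (x := p))).2

omit [IsManifold 𝓘(ℝ, EM) ∞ M] in
/-- The chart of `π^*TN` induced by the preferred charts of `M` and `N`. -/
theorem extChartAt_pullback_apply {p q : PullbackTangent π}
    (hn : π q.proj ∈ (chartAt EN (π p.proj)).source) :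
    extChartAt (𝓘(ℝ, EM).prod 𝓘(ℝ, EN)) p q =
      (extChartAt 𝓘(ℝ, EM) p.proj q.proj, fibreCoord EN (π p.proj) (pullbackToTN π q)) := by
  rw [fibreCoord_eq_snd (w := pullbackToTN π q) hn, FiberBundle.extChartAt]
  rfl

end Projection

/-! ### Extension of tangent vectors to vector fields -/

section Extension

variable {E : Type*} [NormedAddCommGroup E] [NormedSpace ℝ E] [FiniteDimensional ℝ E]
  {M : Type*} [TopologicalSpace M] [T2Space M] [ChartedSpace E M] [IsManifold 𝓘(ℝ, E) ∞ M]

/-- A vector field given in the preferred chart at `m₀` can be cut off to a smooth vector field on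
`M` with the same value at `m₀`. The cut-off takes place inside any given neighbourhood of `m₀`. -/
theorem exists_smoothField (m₀ : M) {Y : E → E}
    (hY : ∀ᶠ x in 𝓝 (extChartAt 𝓘(ℝ, E) m₀ m₀), ContDiffAt ℝ ∞ Y x) {P : M → Prop}
    (hP : ∀ᶠ m in 𝓝 m₀, P m) :
    ∃ X : (m : M) → TangentSpace 𝓘(ℝ, E) m, IsSmoothField X ∧
      X m₀ = Y (extChartAt 𝓘(ℝ, E) m₀ m₀) ∧
      ∀ m, ∃ c : ℝ, X m = c • fibreSymm E m₀ (extChartAt 𝓘(ℝ, E) m₀ m)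
        (Y (extChartAt 𝓘(ℝ, E) m₀ m)) ∧ (c ≠ 0 → P m ∧ m ∈ (chartAt E m₀).source) := by
  let s : (m : M) → TangentSpace 𝓘(ℝ, E) m := fun m =>
    fibreSymm E m₀ (extChartAt 𝓘(ℝ, E) m₀ m) (Y (extChartAt 𝓘(ℝ, E) m₀ m))
  have hs : ∀ m ∈ (chartAt E m₀).source, fibreCoord E m₀ (⟨m, s m⟩ : TangentBundle 𝓘(ℝ, E) M) =
      Y (extChartAt 𝓘(ℝ, E) m₀ m) := fun m hm => by
    have h := fibreCoord_tangentChartSymm (E := E) (m₀ := m₀) (x := extChartAt 𝓘(ℝ, E) m₀ m)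
      (Y (extChartAt 𝓘(ℝ, E) m₀ m)) ((extChartAt 𝓘(ℝ, E) m₀).map_source (by simpa using hm))
    unfold tangentChartSymm at h
    rwa [(extChartAt 𝓘(ℝ, E) m₀).left_inv (by simpa using hm)] at h
  have hev : ∀ᶠ m in 𝓝 m₀, m ∈ (chartAt E m₀).source ∧
      ContDiffAt ℝ ∞ Y (extChartAt 𝓘(ℝ, E) m₀ m) ∧ P m :=
    ((chartAt E m₀).open_source.eventually_mem (mem_chart_source E m₀)).and
      (((continuousAt_extChartAt m₀).eventually hY).and hP)
  obtain ⟨U, hU, hUo, hmU⟩ := eventually_nhds_iff.1 hev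
  have hsU : ContMDiffOn 𝓘(ℝ, E) 𝓘(ℝ, E).tangent ∞
      (fun m => (⟨m, s m⟩ : TangentBundle 𝓘(ℝ, E) M)) U := by
    intro m hm
    obtain ⟨hm1, hm2, -⟩ := hU m hm
    refine ContMDiffAt.contMDiffWithinAt ?_
    have h3 : m ∈ (trivializationAt E (TangentSpace 𝓘(ℝ, E) : M → Type _) m₀).baseSet := by
      simpa using hm1
    refine (Bundle.Trivialization.contMDiffAt_section_iff _ h3).2 ?_
    have h4 : ContMDiffAt 𝓘(ℝ, E) 𝓘(ℝ, E) ∞ (fun m => Y (extChartAt 𝓘(ℝ, E) m₀ m)) m :=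
      hm2.contMDiffAt.comp m (contMDiffAt_extChartAt' hm1)
    refine h4.congr_of_eventuallyEq ?_
    filter_upwards [(chartAt E m₀).open_source.mem_nhds hm1] with m' hm'
    rw [← hs m' hm', fibreCoord_eq_snd hm']
  obtain ⟨χ, -, hχ⟩ := (SmoothBumpFunction.nhds_basis_tsupport (I := 𝓘(ℝ, E)) m₀).mem_iff.1
    (hUo.mem_nhds hmU)
  refine ⟨fun m => χ m • s m,
    ContMDiffOn.smul_section_of_tsupport χ.contMDiff.contMDiffOn hUo hχ hsU, ?_, fun m => ?_⟩
  · have h1 : s m₀ = Y (extChartAt 𝓘(ℝ, E) m₀ m₀) := by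
      rw [← hs m₀ (mem_chart_source E m₀)]
      exact (fibreCoord_self (E := E) m₀ (s m₀)).symm
    change χ m₀ • s m₀ = _
    rw [χ.eq_one, one_smul, h1]
  · refine ⟨χ m, rfl, fun hc => ?_⟩
    have := hU m (hχ (subset_tsupport _ hc))
    exact ⟨this.2.2, this.1⟩

/-- Every tangent vector is the value of a smooth vector field. -/
theorem exists_smoothField_apply_eq (m : M) (y : E) :
    ∃ X : (m : M) → TangentSpace 𝓘(ℝ, E) m, IsSmoothField X ∧ X m = y := by
  obtain ⟨X, h1, h2, -⟩ := exists_smoothField (E := E) m (Y := fun _ => y)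
    (Eventually.of_forall fun _ => contDiffAt_const) (P := fun _ => True)
    (Eventually.of_forall fun _ => trivial)
  exact ⟨X, h1, h2⟩

variable {EN : Type*} [NormedAddCommGroup EN] [NormedSpace ℝ EN] [FiniteDimensional ℝ EN]
  {N : Type*} [TopologicalSpace N] [ChartedSpace EN N] [IsManifold 𝓘(ℝ, EN) ∞ N]
  (π : C^∞⟮𝓘(ℝ, E), M; 𝓘(ℝ, EN), N⟯)

/-- Every vertical vector of a submersion is the value of a vertical vector field. With a right
inverse `R` of `Df(x₀)`, the field is `y - R (Df(x) R)⁻¹ Df(x) y` near `x₀` in charts. -/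
theorem exists_verticalField {m₀ : M} (hsurj : Function.Surjective (projDeriv π m₀)) {y : E}
    (hy : projDeriv π m₀ y = 0) :
    ∃ Y : (m : M) → TangentSpace 𝓘(ℝ, E) m, IsVerticalField π Y ∧ Y m₀ = y := by
  set f := localMap π m₀ with hf
  set x₀ := extChartAt 𝓘(ℝ, E) m₀ m₀ with hx₀
  obtain ⟨R, hR⟩ := (projDeriv π m₀).exists_rightInverse_of_surjective
    (LinearMap.range_eq_top.2 hsurj)
  have hfx₀ : fderiv ℝ f x₀ = projDeriv π m₀ := fderiv_localMap_self π m₀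
  have hev : ∀ᶠ x in 𝓝 x₀, ContDiffAt ℝ ∞ f x := by
    have h1 := eventually_mem_chart_source π m₀
    have h2 : Tendsto (extChartAt 𝓘(ℝ, E) m₀).symm (𝓝 x₀) (𝓝 m₀) := by
      have := (continuousAt_extChartAt_symm (I := 𝓘(ℝ, E)) m₀).tendsto
      rwa [extChartAt_to_inv] at this
    filter_upwards [h2.eventually h1, extChartAt_target_mem_nhds (I := 𝓘(ℝ, E)) m₀] with x hx hx'
    have := contDiffAt_localMap π hx.1 hx.2
    rwa [(extChartAt 𝓘(ℝ, E) m₀).right_inv hx'] at this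
  have hdf : ∀ x, ContDiffAt ℝ ∞ f x → ContDiffAt ℝ ∞ (fun x => (fderiv ℝ f x).comp R) x :=
    fun x hx => (hx.fderiv_right (m := ∞) (by simp)).clm_comp contDiffAt_const
  have hinv : ∀ᶠ x in 𝓝 x₀, ((fderiv ℝ f x).comp R).IsInvertible := by
    have h1 := ((hdf x₀ hev.self_of_nhds).continuousAt).tendsto
    rw [hfx₀, hR] at h1
    exact h1.eventually (ContinuousLinearEquiv.nhds (ContinuousLinearEquiv.refl ℝ EN))
  let Y : E → E := fun x => y - R (((fderiv ℝ f x).comp R).inverse (fderiv ℝ f x y))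
  have hYsm : ∀ᶠ x in 𝓝 x₀, ContDiffAt ℝ ∞ Y x := by
    filter_upwards [hev, hinv] with x hx hix
    obtain ⟨e, he⟩ := hix
    have h1 : ContDiffAt ℝ ∞ (fun x => ((fderiv ℝ f x).comp R).inverse) x :=
      ContDiffAt.comp x (g := ContinuousLinearMap.inverse) (he ▸ contDiffAt_map_inverse e)
        (hdf x hx)
    have h2 : ContDiffAt ℝ ∞ (fun x => fderiv ℝ f x y) x :=
      (hx.fderiv_right (m := ∞) (by simp)).clm_apply contDiffAt_const
    exact contDiffAt_const.sub (R.contDiff.contDiffAt.comp x (h1.clm_apply h2))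
  have hYv : ∀ᶠ x in 𝓝 x₀, fderiv ℝ f x (Y x) = 0 := by
    filter_upwards [hinv] with x hix
    have h := DFunLike.congr_fun hix.self_comp_inverse (fderiv ℝ f x y)
    simp only [ContinuousLinearMap.comp_apply, ContinuousLinearMap.id_apply] at h
    simp only [Y, map_sub]
    rw [h, sub_self]
  have hP : ∀ᶠ m in 𝓝 m₀, π m ∈ (chartAt EN (π m₀)).source ∧
      fderiv ℝ f (extChartAt 𝓘(ℝ, E) m₀ m) (Y (extChartAt 𝓘(ℝ, E) m₀ m)) = 0 :=
    ((eventually_mem_chart_source π m₀).mono fun m hm => hm.2).and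
      ((continuousAt_extChartAt m₀).eventually hYv)
  obtain ⟨X, hX1, hX2, hX3⟩ := exists_smoothField m₀ hYsm hP
  refine ⟨X, ⟨hX1, fun m => ?_⟩, ?_⟩
  · change projDeriv π m (X m) = 0
    obtain ⟨c, hc, hc'⟩ := hX3 m
    by_cases h0 : c = 0
    · rw [hc, h0]
      exact (congrArg (projDeriv π m) (zero_smul ℝ _)).trans (map_zero _)
    · obtain ⟨⟨hn, hv⟩, hm⟩ := hc' h0
      have h1 := fibreCoord_projDeriv π hm hn
        (fibreSymm E m₀ (extChartAt 𝓘(ℝ, E) m₀ m) (Y (extChartAt 𝓘(ℝ, E) m₀ m)))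
      have h2 := fibreCoord_tangentChartSymm (E := E) (m₀ := m₀) (x := extChartAt 𝓘(ℝ, E) m₀ m)
        (Y (extChartAt 𝓘(ℝ, E) m₀ m)) ((extChartAt 𝓘(ℝ, E) m₀).map_source (by simpa using hm))
      unfold tangentChartSymm at h2
      rw [(extChartAt 𝓘(ℝ, E) m₀).left_inv (by simpa using hm)] at h2
      rw [h2, hv, ← fibreCoord_zero (π m₀) (π m)] at h1
      have h3 := fibreCoord_injOn hn h1
      rw [hc]
      refine (map_smul (projDeriv π m) c _).trans ?_
      rw [h3, smul_zero]
  · rw [hX2]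
    simp only [Y]
    rw [hfx₀, hy, map_zero, map_zero, sub_zero]

end Extension

/-! ### Horizontal lifts -/

section HorizontalLift

set_option linter.unusedSectionVars false

variable {EM : Type*} [NormedAddCommGroup EM] [NormedSpace ℝ EM] [FiniteDimensional ℝ EM]
  {M : Type*} [TopologicalSpace M] [ChartedSpace EM M] [IsManifold 𝓘(ℝ, EM) ∞ M]
  {EN : Type*} [NormedAddCommGroup EN] [NormedSpace ℝ EN]
  {N : Type*} [TopologicalSpace N] [ChartedSpace EN N] [IsManifold 𝓘(ℝ, EN) ∞ N]
  (π : C^∞⟮𝓘(ℝ, EM), M; 𝓘(ℝ, EN), N⟯) (F : TangentBundle 𝓘(ℝ, EM) M → ℝ)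

/-- `u` is a horizontal lift of `v` to `m`: it projects to `v` and the energy is stationary at `u`
along the vertical directions. -/
def IsHorizontalLift (m : M) (v : EN) (u : EM) : Prop :=
  projDeriv π m u = v ∧ ∀ y : EM, projDeriv π m y = 0 →
    deriv (fun t : ℝ => energy F (⟨m, u + t • y⟩ : TangentBundle 𝓘(ℝ, EM) M)) 0 = 0

/-- The horizontal lift; for a Finsler function and a submersion it exists and is unique. -/
def horizontalLift (m : M) (v : EN) : EM :=
  Classical.epsilon (IsHorizontalLift π F m v)

/-- The map `(m, v) ↦ h(m, v)` given by the horizontal lifts. -/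
def horizontalMap (p : PullbackTangent π) : TangentBundle 𝓘(ℝ, EM) M :=
  ⟨p.proj, horizontalLift (EM := EM) (EN := EN) π F p.proj p.2⟩

variable {π F} (hF : IsFinsler F) (hsurj : ∀ m, Function.Surjective (projDeriv π m))

section
include hF

omit [FiniteDimensional ℝ EM] in
theorem IsHorizontalLift.unique {m : M} {v : EN} {u u' : EM} (h : IsHorizontalLift π F m v u)
    (h' : IsHorizontalLift π F m v u') : u' = u :=
  (hF.isMinkowskiEnergy m).eq_of_stationary (projDeriv π m) (h'.1.trans h.1.symm) h.2 h'.2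

include hsurj

theorem isHorizontalLift_horizontalLift (m : M) (v : EN) :
    IsHorizontalLift π F m v (horizontalLift π F m v) :=
  Classical.epsilon_spec
    ((hF.isMinkowskiEnergy m).exists_stationary (projDeriv π m) (hsurj m) v)

theorem horizontalLift_eq {m : M} {v : EN} {u : EM} (h : IsHorizontalLift π F m v u) :
    horizontalLift π F m v = u :=
  h.unique hF (isHorizontalLift_horizontalLift hF hsurj m v)

theorem projDeriv_horizontalLift (m : M) (v : EN) :
    projDeriv π m (horizontalLift π F m v) = v :=
  (isHorizontalLift_horizontalLift hF hsurj m v).1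

theorem horizontalLift_zero (m : M) : horizontalLift π F m 0 = 0 := by
  refine horizontalLift_eq hF hsurj ⟨map_zero _, fun y _ => ?_⟩
  refine IsLocalMin.deriv_eq_zero (Eventually.of_forall fun t => ?_)
  have h0 := (hF.isMinkowskiEnergy m).map_zero
  have h1 := (hF.isMinkowskiEnergy m).nonneg (0 + t • y)
  simp only [zero_smul, add_zero]
  rw [h0]
  exact h1

theorem horizontalLift_ne_zero {m : M} {v : EN} (hv : v ≠ 0) : horizontalLift π F m v ≠ 0 :=
  fun h => hv (by rw [← projDeriv_horizontalLift hF hsurj m v, h, map_zero])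

theorem horizontalLift_smul (m : M) (v : EN) {c : ℝ} (hc : 0 < c) :
    horizontalLift π F m (c • v) = c • horizontalLift π F m v := by
  have h := isHorizontalLift_horizontalLift hF hsurj m v
  refine horizontalLift_eq hF hsurj ⟨by rw [map_smul, h.1], fun y hy => ?_⟩
  have h1 := h.2 (c⁻¹ • y) (by rw [map_smul, hy, smul_zero])
  have h2 : (fun t : ℝ => energy F
      (⟨m, c • horizontalLift (EM := EM) π F m v + t • y⟩ : TangentBundle 𝓘(ℝ, EM) M)) =
      fun t : ℝ => c ^ 2 * energy F
        (⟨m, horizontalLift (EM := EM) π F m v + t • (c⁻¹ • y)⟩ : TangentBundle 𝓘(ℝ, EM) M) := by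
    ext t
    rw [← (hF.isMinkowskiEnergy m).homogeneous _ c hc]
    congr 2
    rw [smul_add, smul_comm t, smul_inv_smul₀ hc.ne']
  rw [h2, deriv_const_mul_field, h1, mul_zero]

/-- The horizontal lift has the least length among all lifts. -/
theorem map_horizontalLift_le (m : M) (u : EM) :
    F (⟨m, horizontalLift (EM := EM) π F m (projDeriv π m u)⟩ : TangentBundle 𝓘(ℝ, EM) M) ≤
      F ⟨m, u⟩ := by
  rw [← hF.energy_le_iff]
  have h := isHorizontalLift_horizontalLift hF hsurj m (projDeriv π m u)
  by_cases hu : u = horizontalLift π F m (projDeriv π m u)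
  · rw [← hu]
  · exact ((hF.isMinkowskiEnergy m).lt_of_stationary (projDeriv π m) h.2 h.1.symm hu).le

variable [FiniteDimensional ℝ EN]

/-- In charts, the horizontal lift is the solution of the Lagrange system near any nonzero `v`. -/
theorem exists_isLocalSplitting_horizontalLift (p : PullbackTangent π) (hp : p ∈ slitPullback π) :
    ∃ g lam, IsLocalSplitting (energy F ∘ tangentChartSymm EM p.proj) (localMap π p.proj) g lam
      (extChartAt 𝓘(ℝ, EM) p.proj p.proj) p.2 (horizontalLift π F p.proj p.2) ∧
    ∀ᶠ p' in 𝓝 p, fibreCoord EM p.proj (horizontalMap π F p') =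
      g (extChartAt 𝓘(ℝ, EM) p.proj p'.proj,
        fibreCoord EN (π p.proj) (pullbackToTN π p')) := by
  obtain ⟨m₀, v₀⟩ := p
  change EN at v₀
  have hv₀ : v₀ ≠ 0 := hp
  set x₀ := extChartAt 𝓘(ℝ, EM) m₀ m₀ with hx₀
  set f := localMap π m₀ with hf
  set e := energy F ∘ tangentChartSymm EM m₀ with he
  set u₀ := horizontalLift π F m₀ v₀ with hu₀
  have hu₀ne : u₀ ≠ 0 := horizontalLift_ne_zero hF hsurj hv₀
  have hlift := isHorizontalLift_horizontalLift hF hsurj m₀ v₀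
  have hesm : ContDiffAt ℝ ∞ e (x₀, u₀) := hF.contDiffAt_energy hu₀ne
  have hfx₀ : fderiv ℝ f x₀ = projDeriv π m₀ := fderiv_localMap_self π m₀
  -- The derivative of the energy along a fibre, in the chart.
  have hline : ∀ {m : M}, m ∈ (chartAt EM m₀).source → ∀ u y : EM,
      DifferentiableAt ℝ e (extChartAt 𝓘(ℝ, EM) m₀ m,
        fibreCoord EM m₀ (⟨m, u⟩ : TangentBundle 𝓘(ℝ, EM) M)) →
      deriv (fun t : ℝ => energy F (⟨m, u + t • y⟩ : TangentBundle 𝓘(ℝ, EM) M)) 0 =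
        fderiv ℝ e (extChartAt 𝓘(ℝ, EM) m₀ m,
          fibreCoord EM m₀ (⟨m, u⟩ : TangentBundle 𝓘(ℝ, EM) M))
          (0, fibreCoord EM m₀ (⟨m, y⟩ : TangentBundle 𝓘(ℝ, EM) M)) := by
    intro m hm u y hd
    have hl : HasDerivAt (fun t : ℝ => (extChartAt 𝓘(ℝ, EM) m₀ m,
        fibreCoord EM m₀ (⟨m, u⟩ : TangentBundle 𝓘(ℝ, EM) M)
          + t • fibreCoord EM m₀ (⟨m, y⟩ : TangentBundle 𝓘(ℝ, EM) M)))
        (0, fibreCoord EM m₀ (⟨m, y⟩ : TangentBundle 𝓘(ℝ, EM) M)) 0 := by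
      refine (hasDerivAt_const (0 : ℝ) _).prodMk ?_
      simpa using ((hasDerivAt_id (0 : ℝ)).smul_const
        (fibreCoord EM m₀ (⟨m, y⟩ : TangentBundle 𝓘(ℝ, EM) M))).const_add
          (fibreCoord EM m₀ (⟨m, u⟩ : TangentBundle 𝓘(ℝ, EM) M))
    have h := hd.hasFDerivAt.comp_hasDerivAt_of_eq (0 : ℝ) hl (by simp)
    rw [← h.deriv]
    congr 1
    ext t
    simp only [Function.comp, he]
    have h1 := fibreCoord_add_smul (E := EM) m₀ m u y t
    have h2 := tangentChartSymm_fibreCoord (E := EM) (m₀ := m₀)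
      (w := (⟨m, u + t • y⟩ : TangentBundle 𝓘(ℝ, EM) M)) hm
    rw [← h2]
    exact congrArg (fun z => energy F (tangentChartSymm EM m₀ (extChartAt 𝓘(ℝ, EM) m₀ m, z))) h1
  have hst : ∀ y, fderiv ℝ f x₀ y = 0 → fderiv ℝ e (x₀, u₀) (0, y) = 0 := by
    intro y hy
    rw [hfx₀] at hy
    have h1 := hline (mem_chart_source EM m₀) u₀ y
    rw [fibreCoord_self, fibreCoord_self] at h1
    rw [← h1 (hesm.differentiableAt (by simp))]
    exact hlift.2 y hy
  obtain ⟨g, lam, H⟩ := exists_isLocalSplitting hesm (contDiffAt_localMap π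
    (mem_chart_source EM m₀) (mem_chart_source EN (π m₀))) (by rw [hfx₀]; exact hsurj m₀) hst
    (fun w hw => hF.hessian_energy_pos hu₀ne hw)
  rw [hfx₀, hlift.1] at H
  refine ⟨g, lam, H, ?_⟩
  -- The chart of `π^*TN` is continuous.
  have hproj : Tendsto (fun p' : PullbackTangent π => p'.proj)
      (𝓝 (⟨m₀, v₀⟩ : PullbackTangent π)) (𝓝 m₀) :=
    (FiberBundle.continuous_proj EN (π *ᵖ (TangentSpace 𝓘(ℝ, EN) : N → Type _))).tendsto
      (⟨m₀, v₀⟩ : PullbackTangent π)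
  have hcoord : Tendsto (fun p' : PullbackTangent π => (extChartAt 𝓘(ℝ, EM) m₀ p'.proj,
      fibreCoord EN (π m₀) (pullbackToTN π p'))) (𝓝 (⟨m₀, v₀⟩ : PullbackTangent π))
      (𝓝 (x₀, v₀)) := by
    refine Tendsto.prodMk_nhds ((continuousAt_extChartAt m₀).tendsto.comp hproj) ?_
    exact (tendsto_fibreCoord (E := EN) (pullbackToTN π (⟨m₀, v₀⟩ : PullbackTangent π))).comp
      (contMDiff_pullbackToTN π).continuous.continuousAt.tendsto
  have hediff : ∀ᶠ q in 𝓝 (x₀, v₀), DifferentiableAt ℝ e (q.1, g q) := by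
    have h1 : ∀ᶠ z in 𝓝 (x₀, u₀), DifferentiableAt ℝ e z :=
      ((hesm.of_le (m := 1) (WithTop.coe_le_coe.2 le_top)).eventually
        (by simp)).mono fun q hq => hq.differentiableAt (by simp)
    have h2 : Tendsto (fun q : EM × EN => (q.1, g q)) (𝓝 (x₀, v₀)) (𝓝 (x₀, u₀)) := by
      have := continuousAt_fst.prodMk H.contDiffAt_splitting.continuousAt
      simpa [ContinuousAt, H.apply_self] using this
    exact h2.eventually h1
  filter_upwards [hproj.eventually (eventually_mem_chart_source π m₀),
    hcoord.eventually (hediff.and (H.split.and H.lagrange))] with p' hp1 hp2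
  obtain ⟨m, v⟩ := p'
  change EN at v
  obtain ⟨hm, hn⟩ := hp1
  obtain ⟨hd, hsplit, hlag⟩ := hp2
  set q : EM × EN := (extChartAt 𝓘(ℝ, EM) m₀ m,
    fibreCoord EN (π m₀) (pullbackToTN π (⟨m, v⟩ : PullbackTangent π))) with hq
  set u : EM := fibreSymm EM m₀ q.1 (g q) with hu
  have hinv : (extChartAt 𝓘(ℝ, EM) m₀).symm q.1 = m :=
    (extChartAt 𝓘(ℝ, EM) m₀).left_inv (by simpa using hm)
  have hcu : fibreCoord EM m₀ (⟨m, u⟩ : TangentBundle 𝓘(ℝ, EM) M) = g q := by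
    have h := fibreCoord_tangentChartSymm (E := EM) (m₀ := m₀) (x := q.1) (g q)
      ((extChartAt 𝓘(ℝ, EM) m₀).map_source (by simpa using hm))
    unfold tangentChartSymm at h
    rwa [hinv] at h
  have key : IsHorizontalLift π F m v u := by
    constructor
    · refine fibreCoord_injOn hn ?_
      rw [fibreCoord_projDeriv π hm hn, hcu]
      exact hsplit
    · intro y hy
      rw [hline hm u y (by rw [hcu]; exact hd), hcu]
      refine (hlag _).trans ?_
      have h1 := fibreCoord_projDeriv π hm hn y
      rw [hy, fibreCoord_zero] at h1
      exact (congrArg (lam q) h1.symm).trans (map_zero _)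
  rw [← hcu, ← horizontalLift_eq hF hsurj key]
  rfl

/-- The splitting is smooth off the zero vectors, since its coordinate expression solves the
Lagrange system. -/
theorem contMDiffAt_horizontalMap {p : PullbackTangent π} (hp : p ∈ slitPullback π) :
    ContMDiffAt (𝓘(ℝ, EM).prod 𝓘(ℝ, EN)) 𝓘(ℝ, EM).tangent ∞ (horizontalMap π F) p := by
  obtain ⟨g, lam, H, hev⟩ := exists_isLocalSplitting_horizontalLift hF hsurj p hp
  have h0 := (contMDiffAt_id (I := 𝓘(ℝ, EM).prod 𝓘(ℝ, EN)) (n := ∞) (x := p))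
  have hproj := ((contMDiffAt_pullback_iff π).1 h0).1
  have hTN := ((contMDiffAt_pullback_iff π).1 h0).2
  refine Bundle.contMDiffAt_totalSpace.2 ⟨hproj, ?_⟩
  have hcoordN : ContMDiffAt (𝓘(ℝ, EM).prod 𝓘(ℝ, EN)) 𝓘(ℝ, EN) ∞
      (fun p' : PullbackTangent π => fibreCoord EN (π p.proj) (pullbackToTN π p')) p := by
    refine (Bundle.contMDiffAt_totalSpace.1 hTN).2.congr_of_eventuallyEq ?_
    filter_upwards [hproj.continuousAt (eventually_mem_chart_source π p.proj)] with p' hp'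
    exact fibreCoord_eq_snd (E := EN) (w := pullbackToTN π p') hp'.2
  have hcoordM : ContMDiffAt (𝓘(ℝ, EM).prod 𝓘(ℝ, EN)) 𝓘(ℝ, EM) ∞
      (fun p' : PullbackTangent π => extChartAt 𝓘(ℝ, EM) p.proj p'.proj) p :=
    ContMDiffAt.comp p (contMDiffAt_extChartAt (x := p.proj)) hproj
  have hg : ContMDiffAt 𝓘(ℝ, EM × EN) 𝓘(ℝ, EM) ∞ g (extChartAt 𝓘(ℝ, EM) p.proj p.proj,
      fibreCoord EN (π p.proj) (pullbackToTN π p)) := by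
    have h1 : fibreCoord EN (π p.proj) (pullbackToTN π p) = p.2 := fibreCoord_self (E := EN) _ p.2
    rw [h1]
    exact H.contDiffAt_splitting.contMDiffAt
  have hcomp := ContMDiffAt.comp p hg (hcoordM.prodMk_space hcoordN)
  refine hcomp.congr_of_eventuallyEq ?_
  filter_upwards [hev, hproj.continuousAt (eventually_mem_chart_source π p.proj)] with p' hp' hp''
  exact (fibreCoord_eq_snd (E := EM) (w := horizontalMap π F p') hp''.1).symm.trans hp'

/-- The differential of the splitting in charts. -/
theorem mfderiv_horizontalMap {p : PullbackTangent π} (hp : p ∈ slitPullback π)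
    {g : EM × EN → EM} (hg : DifferentiableAt ℝ g (extChartAt 𝓘(ℝ, EM) p.proj p.proj, p.2))
    (hev : ∀ᶠ p' in 𝓝 p, fibreCoord EM p.proj (horizontalMap π F p') =
      g (extChartAt 𝓘(ℝ, EM) p.proj p'.proj,
        fibreCoord EN (π p.proj) (pullbackToTN π p'))) (a : EM) (b : EN) :
    (mfderiv (𝓘(ℝ, EM).prod 𝓘(ℝ, EN)) 𝓘(ℝ, EM).tangent (horizontalMap π F) p (a, b) : EM × EM) =
      (a, fderiv ℝ g (extChartAt 𝓘(ℝ, EM) p.proj p.proj, p.2) (a, b)) := by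
  have h1 := (contMDiffAt_horizontalMap hF hsurj hp).continuousAt
  have hself : extChartAt (𝓘(ℝ, EM).prod 𝓘(ℝ, EN)) p p =
      (extChartAt 𝓘(ℝ, EM) p.proj p.proj, p.2) := by
    rw [extChartAt_pullback_apply π (mem_chart_source EN (π p.proj))]
    exact congrArg (Prod.mk _) (fibreCoord_self (E := EN) _ p.2)
  have h2 : HasMFDerivAt (𝓘(ℝ, EM).prod 𝓘(ℝ, EN)) 𝓘(ℝ, EM).tangent (horizontalMap π F) p
      ((ContinuousLinearMap.fst ℝ EM EN).prod
        (fderiv ℝ g (extChartAt 𝓘(ℝ, EM) p.proj p.proj, p.2))) := by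
    refine ⟨h1, HasFDerivAt.hasFDerivWithinAt ?_⟩
    rw [hself]
    have h3 := (hasFDerivAt_fst (𝕜 := ℝ) (E := EM) (F := EN)
      (p := (extChartAt 𝓘(ℝ, EM) p.proj p.proj, (p.2 : EN)))).prodMk hg.hasFDerivAt
    refine h3.congr_of_eventuallyEq ?_
    have h4 : Tendsto (extChartAt (𝓘(ℝ, EM).prod 𝓘(ℝ, EN)) p).symm
        (𝓝 (extChartAt 𝓘(ℝ, EM) p.proj p.proj, (p.2 : EN))) (𝓝 p) := by
      have := (continuousAt_extChartAt_symm (I := 𝓘(ℝ, EM).prod 𝓘(ℝ, EN)) p).tendsto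
      rwa [extChartAt_to_inv, hself] at this
    have h5 : (extChartAt (𝓘(ℝ, EM).prod 𝓘(ℝ, EN)) p).target ∈
        𝓝 (extChartAt 𝓘(ℝ, EM) p.proj p.proj, (p.2 : EN)) := by
      have := extChartAt_target_mem_nhds (I := 𝓘(ℝ, EM).prod 𝓘(ℝ, EN)) p
      rwa [hself] at this
    have hproj : Tendsto (fun p' : PullbackTangent π => p'.proj) (𝓝 p) (𝓝 p.proj) :=
      (FiberBundle.continuous_proj EN (π *ᵖ (TangentSpace 𝓘(ℝ, EN) : N → Type _))).tendsto p
    filter_upwards [h4.eventually (hev.and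
      (hproj.eventually (eventually_mem_chart_source π p.proj))), h5] with q hq hq'
    obtain ⟨hq1, hq2, hq3⟩ := hq
    have h6 := extChartAt_pullback_apply π (p := p)
      (q := (extChartAt (𝓘(ℝ, EM).prod 𝓘(ℝ, EN)) p).symm q) hq3
    rw [(extChartAt (𝓘(ℝ, EM).prod 𝓘(ℝ, EN)) p).right_inv hq'] at h6
    simp only [writtenInExtChartAt, Function.comp]
    refine (extChartAt_tangent_apply (u := horizontalMap π F p) (w := horizontalMap π F
      ((extChartAt (𝓘(ℝ, EM).prod 𝓘(ℝ, EN)) p).symm q)) hq2).trans ?_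
    refine Prod.ext (congrArg Prod.fst h6).symm ?_
    refine hq1.trans ?_
    rw [← h6]
  exact DFunLike.congr_fun h2.mfderiv (a, b)

end

end HorizontalLift

/-! ### The canonical spray -/

section Spray

set_option linter.unusedSectionVars false

variable {E : Type*} [NormedAddCommGroup E] [NormedSpace ℝ E] [FiniteDimensional ℝ E]
  {M : Type*} [TopologicalSpace M] [ChartedSpace E M] [IsManifold 𝓘(ℝ, E) ∞ M]
  {F : TangentBundle 𝓘(ℝ, E) M → ℝ} (hF : IsFinsler F)

/-- The differential of `TM → M`, in charts. -/
theorem mfderiv_tangentProj (m : M) (u : E) (s : E × E) :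
    (mfderiv 𝓘(ℝ, E).tangent 𝓘(ℝ, E) (TotalSpace.proj : TangentBundle 𝓘(ℝ, E) M → M)
      (⟨m, u⟩ : TangentBundle 𝓘(ℝ, E) M) s : E) = s.1 := by
  have h : HasMFDerivAt 𝓘(ℝ, E).tangent 𝓘(ℝ, E)
      (TotalSpace.proj : TangentBundle 𝓘(ℝ, E) M → M) (⟨m, u⟩ : TangentBundle 𝓘(ℝ, E) M)
      (ContinuousLinearMap.fst ℝ E E) := by
    refine ⟨(FiberBundle.continuous_proj E (TangentSpace 𝓘(ℝ, E) : M → Type _)).continuousAt,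
      HasFDerivAt.hasFDerivWithinAt ?_⟩
    have h1 : HasFDerivAt (Prod.fst : E × E → E) (ContinuousLinearMap.fst ℝ E E)
      (extChartAt 𝓘(ℝ, E) m m, u) := hasFDerivAt_fst
    rw [← extChartAt_tangent_self (M := M)] at h1
    refine h1.congr_of_eventuallyEq ?_
    have h2 : ∀ᶠ q : E × E in 𝓝 (extChartAt 𝓘(ℝ, E) m m, u),
        q.1 ∈ (extChartAt 𝓘(ℝ, E) m).target :=
      (continuous_fst.tendsto (extChartAt 𝓘(ℝ, E) m m, u)).eventually
        (extChartAt_target_mem_nhds (I := 𝓘(ℝ, E)) m)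
    rw [← extChartAt_tangent_self (M := M)] at h2
    filter_upwards [h2] with q hq
    have h3 := extChartAt_tangent_symm_apply (⟨m, u⟩ : TangentBundle 𝓘(ℝ, E) M) hq
    simp only [writtenInExtChartAt, Function.comp]
    rw [h3]
    exact (extChartAt 𝓘(ℝ, E) m).right_inv hq
  exact DFunLike.congr_fun h.mfderiv s

include hF

/-- The energy has a minimum at the zero vectors, so that its differential vanishes there. -/
theorem IsFinsler.dirDeriv_energy_zero (m : M) (s : E × E) :
    dirDeriv (energy F) (⟨m, (0 : E)⟩ : TangentBundle 𝓘(ℝ, E) M) s = 0 := by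
  by_cases hd : MDifferentiableAt 𝓘(ℝ, E).tangent 𝓘(ℝ, ℝ) (energy F)
      (⟨m, (0 : E)⟩ : TangentBundle 𝓘(ℝ, E) M)
  · have h := hd.hasMFDerivAt.2
    rw [ModelWithCorners.Boundaryless.range_eq_univ] at h
    replace h := hasFDerivWithinAt_univ.1 h
    have hmin : IsLocalMin (writtenInExtChartAt 𝓘(ℝ, E).tangent 𝓘(ℝ, ℝ)
        (⟨m, (0 : E)⟩ : TangentBundle 𝓘(ℝ, E) M) (energy F))
        (extChartAt 𝓘(ℝ, E).tangent (⟨m, (0 : E)⟩ : TangentBundle 𝓘(ℝ, E) M)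
          (⟨m, (0 : E)⟩ : TangentBundle 𝓘(ℝ, E) M)) := by
      refine Eventually.of_forall fun q => ?_
      change energy F ((extChartAt 𝓘(ℝ, E).tangent (⟨m, (0 : E)⟩ : TangentBundle 𝓘(ℝ, E) M)).symm
        (extChartAt 𝓘(ℝ, E).tangent (⟨m, (0 : E)⟩ : TangentBundle 𝓘(ℝ, E) M)
          (⟨m, (0 : E)⟩ : TangentBundle 𝓘(ℝ, E) M))) ≤ energy F _
      rw [extChartAt_to_inv]
      have h0 : energy F (⟨m, (0 : E)⟩ : TangentBundle 𝓘(ℝ, E) M) = 0 :=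
        (hF.isMinkowskiEnergy m).map_zero
      rw [h0]
      unfold energy
      positivity
    exact DFunLike.congr_fun (hmin.hasFDerivAt_eq_zero h) s
  -- By homogeneity the energy is differentiable at the zero vectors too. This is not needed, as
  -- otherwise its `mfderiv` vanishes by convention.
  · exact DFunLike.congr_fun (mfderiv_zero_of_not_mdifferentiableAt hd) s

/-- The two sides of the equation of the canonical spray, in charts. -/
theorem IsFinsler.spray_relation {X : (m : M) → TangentSpace 𝓘(ℝ, E) m} (hX : IsSmoothField X)
    {m : M} {u : E} (hu : u ≠ 0) (s : E) :
    dirDeriv (vertLift X (energy F)) (⟨m, u⟩ : TangentBundle 𝓘(ℝ, E) M) ((u, s) : E × E)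
      - completeLift X (energy F) ⟨m, u⟩ =
    fderiv ℝ (fderiv ℝ (energy F ∘ tangentChartSymm E m)) (extChartAt 𝓘(ℝ, E) m m, u) (u, s)
      (0, X m) - fderiv ℝ (energy F ∘ tangentChartSymm E m) (extChartAt 𝓘(ℝ, E) m m, u)
        (X m, 0) := by
  set e := energy F ∘ tangentChartSymm E m with he
  set x₀ := extChartAt 𝓘(ℝ, E) m m with hx₀
  have hesm : ContDiffAt ℝ ∞ e (x₀, u) := hF.contDiffAt_energy hu
  have hXd := (contDiffAt_localField hX m).differentiableAt (by simp)
  obtain ⟨h1, h2⟩ := fderiv_vertLift (s := s) hesm hXd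
  have hev : vertLift X (energy F) ∘ tangentChartSymm E m =ᶠ[𝓝 (x₀, u)]
      fun p => fderiv ℝ e p (0, localField m X p.1) := by
    have hd : ∀ᶠ z in 𝓝 (x₀, u), DifferentiableAt ℝ e z :=
      ((hesm.of_le (m := 1) (WithTop.coe_le_coe.2 le_top)).eventually
        (by simp)).mono fun q hq => hq.differentiableAt (by simp)
    have ht : ∀ᶠ q : E × E in 𝓝 (x₀, u), q.1 ∈ (extChartAt 𝓘(ℝ, E) m).target :=
      (continuous_fst.tendsto (x₀, u)).eventually
        (extChartAt_target_mem_nhds (I := 𝓘(ℝ, E)) m)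
    filter_upwards [hd, ht] with q hq hq' using vertLift_tangentChartSymm _ X hq' hq
  have h3 := h1.congr_of_eventuallyEq hev
  rw [dirDeriv_eq_fderiv h3.differentiableAt, h3.fderiv, completeLift, completeLiftVec_eq hX]
  rw [dirDeriv_eq_fderiv (hesm.differentiableAt (by simp)), h2, localField_self]

/-- The equation of the canonical spray involves only the values of the vector fields at the base
point. As these are arbitrary, it is the geodesic equation `D²e (u, s) (0, y) = ∂ₓe · y` in
charts. -/
theorem IsFinsler.isCanonicalSprayAt_iff [T2Space M] {m : M} {u : E} (hu : u ≠ 0) (s : E × E) :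
    IsCanonicalSprayAt F (⟨m, u⟩ : TangentBundle 𝓘(ℝ, E) M) s ↔ s.1 = u ∧
      ∀ y, fderiv ℝ (fderiv ℝ (energy F ∘ tangentChartSymm E m)) (extChartAt 𝓘(ℝ, E) m m, u)
        (u, s.2) (0, y) =
      fderiv ℝ (energy F ∘ tangentChartSymm E m) (extChartAt 𝓘(ℝ, E) m m, u) (y, 0) := by
  obtain ⟨a, s⟩ := s
  unfold IsCanonicalSprayAt
  have h0 := mfderiv_tangentProj m u (a, s)
  constructor
  · rintro ⟨h1, h2⟩
    have ha : a = u := h0.symm.trans h1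
    subst ha
    refine ⟨rfl, fun y => ?_⟩
    obtain ⟨X, hX, hXm⟩ := exists_smoothField_apply_eq (E := E) m y
    have h3 := hF.spray_relation hX (m := m) hu s
    rw [h2 X hX, hXm] at h3
    exact sub_eq_zero.1 h3.symm
  · rintro ⟨rfl, h2⟩
    refine ⟨h0, fun X hX => ?_⟩
    exact (hF.spray_relation hX hu s).trans (sub_eq_zero.2 (h2 (X m)))

theorem IsFinsler.isCanonicalSprayAt_canonicalSpray [T2Space M] {m : M} {u : E} (hu : u ≠ 0) :
    IsCanonicalSprayAt F (⟨m, u⟩ : TangentBundle 𝓘(ℝ, E) M) (canonicalSpray F ⟨m, u⟩) := by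
  obtain ⟨s, hs⟩ := exists_spray (e := energy F ∘ tangentChartSymm E m)
    (p := (extChartAt 𝓘(ℝ, E) m m, u)) u (fun w hw => hF.hessian_energy_pos hu hw)
  exact Classical.epsilon_spec ⟨((u, s) : E × E), (hF.isCanonicalSprayAt_iff hu (u, s)).2 ⟨rfl, hs⟩⟩

end Spray

/-! ### Tangency of the spray to the horizontal manifold -/

section Tangency

set_option linter.unusedSectionVars false

variable {EM : Type*} [NormedAddCommGroup EM] [NormedSpace ℝ EM] [FiniteDimensional ℝ EM]
  {M : Type*} [TopologicalSpace M] [T2Space M] [ChartedSpace EM M] [IsManifold 𝓘(ℝ, EM) ∞ M]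
  {EN : Type*} [NormedAddCommGroup EN] [NormedSpace ℝ EN] [FiniteDimensional ℝ EN]
  {N : Type*} [TopologicalSpace N] [ChartedSpace EN N] [IsManifold 𝓘(ℝ, EN) ∞ N]
  {π : C^∞⟮𝓘(ℝ, EM), M; 𝓘(ℝ, EN), N⟯} {F : TangentBundle 𝓘(ℝ, EM) M → ℝ}
  (hF : IsFinsler F) (hsurj : ∀ m, Function.Surjective (projDeriv π m))
include hF hsurj

theorem isInducedSplitting_horizontalMap : IsInducedSplitting π F (horizontalMap π F) := by
  refine ⟨⟨fun p hp => (contMDiffAt_horizontalMap hF hsurj hp).contMDiffWithinAt, fun p => rfl,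
    fun p => ?_⟩, fun Y hY p => ?_⟩
  · exact congrArg (TotalSpace.mk (π p.proj)) (projDeriv_horizontalLift hF hsurj p.proj p.2)
  · exact (isHorizontalLift_horizontalLift hF hsurj p.proj p.2).2 (Y p.proj) (hY.2 p.proj)

/-- Vertical fields take all vertical values, so that an induced splitting consists of the
horizontal lifts. -/
theorem IsInducedSplitting.eq_horizontalMap {h : PullbackTangent π → TangentBundle 𝓘(ℝ, EM) M}
    (hh : IsInducedSplitting π F h) : h = horizontalMap π F := by
  ext1 p
  have hproj := hh.1.proj p
  have hsplit := hh.1.split p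
  have hst := fun Y hY => hh.2 Y hY p
  generalize h p = w at hproj hsplit hst
  obtain ⟨m, u⟩ := w
  obtain ⟨m', v⟩ := p
  change m = m' at hproj
  subst hproj
  refine congrArg (TotalSpace.mk m) (horizontalLift_eq hF hsurj ⟨?_, fun y hy => ?_⟩).symm
  · exact eq_of_heq (TotalSpace.mk.inj hsplit).2
  · obtain ⟨Y, hY, hYm⟩ := exists_verticalField π (hsurj m) hy
    have h1 := hst Y hY
    rw [← hYm]
    exact h1

theorem inducedSplitting_eq_horizontalMap : inducedSplitting π F = horizontalMap π F :=
  IsInducedSplitting.eq_horizontalMap hF hsurj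
    (Classical.epsilon_spec ⟨_, isInducedSplitting_horizontalMap hF hsurj⟩)

theorem horizontalMap_of_notMem {p : PullbackTangent π} (hp : p ∉ slitPullback π) :
    horizontalMap π F p = ⟨p.proj, (0 : EM)⟩ := by
  obtain ⟨m, v⟩ := p
  have hv : v = (0 : EN) := not_not.1 hp
  subst hv
  exact congrArg (TotalSpace.mk m) (horizontalLift_zero hF hsurj m)

variable {p : PullbackTangent π} (hp : p ∈ slitPullback π) {g : EM × EN → EM}
  {lam : EM × EN → EN →L[ℝ] ℝ}
  (H : IsLocalSplitting (energy F ∘ tangentChartSymm EM p.proj) (localMap π p.proj) g lam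
      (extChartAt 𝓘(ℝ, EM) p.proj p.proj) p.2 (horizontalLift π F p.proj p.2))
include H

/-- On horizontal vectors, the complete lift of a vertical field is the form
`C(y) = ∂ₓe · y - λ(D²f(y, u₀))` evaluated at the value of the field. -/
theorem completeLift_horizontalMap {Y : (m : M) → TangentSpace 𝓘(ℝ, EM) m}
    (hY : IsVerticalField π Y) :
    completeLift Y (energy F) (horizontalMap π F p) =
      fderiv ℝ (energy F ∘ tangentChartSymm EM p.proj)
        (extChartAt 𝓘(ℝ, EM) p.proj p.proj, horizontalLift π F p.proj p.2) (Y p.proj, 0)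
      - lam (extChartAt 𝓘(ℝ, EM) p.proj p.proj, p.2)
        (fderiv ℝ (fderiv ℝ (localMap π p.proj)) (extChartAt 𝓘(ℝ, EM) p.proj p.proj) (Y p.proj)
          (horizontalLift π F p.proj p.2)) := by
  have hd := (contDiffAt_localField hY.1 p.proj).differentiableAt (by simp)
  have hvert : ∀ᶠ x in 𝓝 (extChartAt 𝓘(ℝ, EM) p.proj p.proj),
      fderiv ℝ (localMap π p.proj) x (localField p.proj Y x) = 0 := by
    have h2 : Tendsto (extChartAt 𝓘(ℝ, EM) p.proj).symm
        (𝓝 (extChartAt 𝓘(ℝ, EM) p.proj p.proj)) (𝓝 p.proj) := by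
      have := (continuousAt_extChartAt_symm (I := 𝓘(ℝ, EM)) p.proj).tendsto
      rwa [extChartAt_to_inv] at this
    filter_upwards [h2.eventually (eventually_mem_chart_source π p.proj),
      extChartAt_target_mem_nhds (I := 𝓘(ℝ, EM)) p.proj] with x hx hx'
    have h3 := fibreCoord_projDeriv π hx.1 hx.2 (Y ((extChartAt 𝓘(ℝ, EM) p.proj).symm x))
    rw [(extChartAt 𝓘(ℝ, EM) p.proj).right_inv hx'] at h3
    refine h3.symm.trans ?_
    have h4 : projDeriv π ((extChartAt 𝓘(ℝ, EM) p.proj).symm x)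
        (Y ((extChartAt 𝓘(ℝ, EM) p.proj).symm x)) = 0 := hY.2 _
    rw [h4]
    exact fibreCoord_zero _ _
  have h5 := H.fderiv_energy_completeLift hd hvert
  rw [localField_self] at h5
  refine Eq.trans ?_ h5
  have h6 := completeLiftVec_eq hY.1 p.proj (horizontalLift π F p.proj p.2)
  rw [localField_self] at h6
  refine (congrArg (dirDeriv (energy F) (horizontalMap π F p)) h6).trans ?_
  exact dirDeriv_eq_fderiv H.hasFDerivAt_energy.differentiableAt _

include hp

/-- The spray is tangent to the horizontal manifold if and only if the form
`C(y) = ∂ₓe · y - λ(D²f(y, u₀))` vanishes on the vertical vectors. -/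
theorem canonicalSpray_mem_range_iff
    (hev : ∀ᶠ p' in 𝓝 p, fibreCoord EM p.proj (horizontalMap π F p') =
      g (extChartAt 𝓘(ℝ, EM) p.proj p'.proj,
        fibreCoord EN (π p.proj) (pullbackToTN π p'))) :
    canonicalSpray F (horizontalMap π F p) ∈
      range (mfderiv (𝓘(ℝ, EM).prod 𝓘(ℝ, EN)) 𝓘(ℝ, EM).tangent (horizontalMap π F) p) ↔
    ∀ y, projDeriv π p.proj y = 0 →
      fderiv ℝ (energy F ∘ tangentChartSymm EM p.proj)
        (extChartAt 𝓘(ℝ, EM) p.proj p.proj, horizontalLift π F p.proj p.2) (y, 0)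
      - lam (extChartAt 𝓘(ℝ, EM) p.proj p.proj, p.2)
        (fderiv ℝ (fderiv ℝ (localMap π p.proj)) (extChartAt 𝓘(ℝ, EM) p.proj p.proj) y
          (horizontalLift π F p.proj p.2)) = 0 := by
  have hu : horizontalLift π F p.proj p.2 ≠ 0 := horizontalLift_ne_zero hF hsurj hp
  have hS := hF.isCanonicalSprayAt_canonicalSpray (m := p.proj) hu
  let S : EM × EM := canonicalSpray F (horizontalMap π F p)
  have hS' := (hF.isCanonicalSprayAt_iff hu S).1 hS
  have hder := mfderiv_horizontalMap hF hsurj hp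
    (H.contDiffAt_splitting.differentiableAt (by simp)) hev
  have h1 := H.exists_fderiv_eq_iff hS'.2
  rw [fderiv_localMap_self] at h1
  rw [← h1]
  constructor
  · rintro ⟨⟨a, b⟩, hab⟩
    have h2 : (a, fderiv ℝ g (extChartAt 𝓘(ℝ, EM) p.proj p.proj, p.2) (a, b)) = S :=
      (hder a b).symm.trans hab
    have ha : a = horizontalLift π F p.proj p.2 := by
      rw [← hS'.1, ← h2]
    refine ⟨b, ?_⟩
    rw [← h2, ← ha]
  · rintro ⟨b, hb⟩
    refine ⟨((horizontalLift π F p.proj p.2, b) : EM × EN), ?_⟩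
    refine (hder _ b).trans ?_
    rw [hb]
    exact Prod.ext hS'.1.symm rfl

end Tangency

section Equivalence

set_option linter.unusedSectionVars false

variable {EM : Type*} [NormedAddCommGroup EM] [NormedSpace ℝ EM] [FiniteDimensional ℝ EM]
  {M : Type*} [TopologicalSpace M] [T2Space M] [ChartedSpace EM M] [IsManifold 𝓘(ℝ, EM) ∞ M]
  {EN : Type*} [NormedAddCommGroup EN] [NormedSpace ℝ EN] [FiniteDimensional ℝ EN]
  {N : Type*} [TopologicalSpace N] [ChartedSpace EN N] [IsManifold 𝓘(ℝ, EN) ∞ N]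
  {π : C^∞⟮𝓘(ℝ, EM), M; 𝓘(ℝ, EN), N⟯} {F : TangentBundle 𝓘(ℝ, EM) M → ℝ}
  (hF : IsFinsler F) (hsurj : ∀ m, Function.Surjective (projDeriv π m))
include hF hsurj

theorem isTangentToImage_iff :
    IsTangentToImage π (horizontalMap π F) (canonicalSpray F) ↔
      ∀ Y : (m : M) → TangentSpace 𝓘(ℝ, EM) m, IsVerticalField π Y →
        ∀ p, completeLift Y (energy F) (horizontalMap π F p) = 0 := by
  constructor
  · intro h Y hY p
    by_cases hp : p ∈ slitPullback π
    · obtain ⟨g, lam, H, hev⟩ := exists_isLocalSplitting_horizontalLift hF hsurj p hp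
      rw [completeLift_horizontalMap hF hsurj H hY]
      exact (canonicalSpray_mem_range_iff hF hsurj hp H hev).1 (h p hp) _ (hY.2 p.proj)
    · rw [horizontalMap_of_notMem hF hsurj hp]
      exact hF.dirDeriv_energy_zero p.proj _
  · intro h p hp
    obtain ⟨g, lam, H, hev⟩ := exists_isLocalSplitting_horizontalLift hF hsurj p hp
    refine (canonicalSpray_mem_range_iff hF hsurj hp H hev).2 fun y hy => ?_
    obtain ⟨Y, hY, hYm⟩ := exists_verticalField π (hsurj p.proj) hy
    have h1 := completeLift_horizontalMap hF hsurj H hY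
    rw [h Y hY p, hYm] at h1
    exact h1.symm

end Equivalence

/-! ### Functions with vanishing differential -/

section LocallyConstant

variable {E : Type*} [NormedAddCommGroup E] [NormedSpace ℝ E]
  {M : Type*} [TopologicalSpace M] [ChartedSpace E M] [IsManifold 𝓘(ℝ, E) ∞ M]

theorem isLocallyConstant_of_hasMFDerivAt_zero {κ : M → ℝ}
    (h : ∀ m, HasMFDerivAt 𝓘(ℝ, E) 𝓘(ℝ, ℝ) κ m (0 : E →L[ℝ] ℝ)) : IsLocallyConstant κ := by
  rw [IsLocallyConstant.iff_eventually_eq]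
  intro m
  have hd : ∀ x ∈ (extChartAt 𝓘(ℝ, E) m).target,
      HasFDerivAt (κ ∘ (extChartAt 𝓘(ℝ, E) m).symm) (0 : E →L[ℝ] ℝ) x := by
    intro x hx
    have h1 : MDifferentiableAt 𝓘(ℝ, E) 𝓘(ℝ, E) (extChartAt 𝓘(ℝ, E) m).symm x := by
      have := mdifferentiableWithinAt_extChartAt_symm (I := 𝓘(ℝ, E)) hx
      rwa [ModelWithCorners.Boundaryless.range_eq_univ, mdifferentiableWithinAt_univ] at this
    have h2 := ((h ((extChartAt 𝓘(ℝ, E) m).symm x)).comp x h1.hasMFDerivAt).hasFDerivAt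
    exact h2.congr_fderiv (ContinuousLinearMap.zero_comp _)
  have hopen := isOpen_extChartAt_target (I := 𝓘(ℝ, E)) m
  have h3 := hopen.isOpen_inter_preimage_of_fderiv_eq_zero
    (f := κ ∘ (extChartAt 𝓘(ℝ, E) m).symm)
    (fun x hx => (hd x hx).differentiableAt.differentiableWithinAt)
    (fun x hx => (hd x hx).fderiv) {κ m}
  have h4 : extChartAt 𝓘(ℝ, E) m m ∈ (extChartAt 𝓘(ℝ, E) m).target ∩
      (κ ∘ (extChartAt 𝓘(ℝ, E) m).symm) ⁻¹' {κ m} :=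
    ⟨mem_extChartAt_target m, by simp⟩
  filter_upwards [(continuousAt_extChartAt (I := 𝓘(ℝ, E)) m) (h3.mem_nhds h4),
    extChartAt_source_mem_nhds (I := 𝓘(ℝ, E)) m] with m' hm' hs
  have h5 : κ ((extChartAt 𝓘(ℝ, E) m).symm (extChartAt 𝓘(ℝ, E) m m')) = κ m := hm'.2
  rwa [(extChartAt 𝓘(ℝ, E) m).left_inv hs] at h5

omit [IsManifold 𝓘(ℝ, E) ∞ M] in
theorem hasMFDerivAt_comp_eq_zero {E' : Type*} [NormedAddCommGroup E'] [NormedSpace ℝ E']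
    {K : E' → ℝ} {c : M → E'} {m : M} {D : E' →L[ℝ] ℝ} {A : E →L[ℝ] E'}
    (hK : HasFDerivAt K D (c m)) (hc : HasMFDerivAt 𝓘(ℝ, E) 𝓘(ℝ, E') c m A)
    (h : ∀ η, D (A η) = 0) :
    HasMFDerivAt 𝓘(ℝ, E) 𝓘(ℝ, ℝ) (fun m => K (c m)) m (0 : E →L[ℝ] ℝ) := by
  have h0 : D.comp A = 0 := ContinuousLinearMap.ext h
  rw [← h0]
  exact hK.hasMFDerivAt.comp m hc

end LocallyConstant

/-! ### Local sections of fibre bundles -/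

section FibreBundle

set_option linter.unusedSectionVars false

variable {EM : Type*} [NormedAddCommGroup EM] [NormedSpace ℝ EM]
  {M : Type*} [TopologicalSpace M] [ChartedSpace EM M] [IsManifold 𝓘(ℝ, EM) ∞ M]
  {EN : Type*} [NormedAddCommGroup EN] [NormedSpace ℝ EN]
  {N : Type*} [TopologicalSpace N] [ChartedSpace EN N] [IsManifold 𝓘(ℝ, EN) ∞ N]
  {EΦ : Type*} [NormedAddCommGroup EΦ] [NormedSpace ℝ EΦ]
  {Φ : Type*} [TopologicalSpace Φ] [ChartedSpace EΦ Φ] [IsManifold 𝓘(ℝ, EΦ) ∞ Φ]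
  {π : C^∞⟮𝓘(ℝ, EM), M; 𝓘(ℝ, EN), N⟯}

/-- A local trivialization gives a smooth family of local sections which sweeps out the part of `M`
over the domain of the trivialization. -/
theorem IsFibreBundle.exists_sections (hπ : IsFibreBundle EΦ Φ π) (n : N) :
    ∃ U : Set N, IsOpen U ∧ n ∈ U ∧ ∃ σ : N × Φ → M,
      ContMDiffOn (𝓘(ℝ, EN).prod 𝓘(ℝ, EΦ)) 𝓘(ℝ, EM) ∞ σ (U ×ˢ univ) ∧
      (∀ z ∈ U ×ˢ (univ : Set Φ), π (σ z) = z.1) ∧ ∀ m, π m ∈ U → ∃ y, σ (π m, y) = m := by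
  obtain ⟨U, hU, hn, ψ, hs, ht, hψ⟩ := hπ n
  refine ⟨U, hU, hn, ψ.invFun, ht ▸ ψ.contMDiffOn_invFun, fun z hz => ?_, fun m hm => ?_⟩
  · have h1 : ψ.invFun z ∈ π ⁻¹' U := hs ▸ ψ.map_target' (by rw [ht]; exact hz)
    have h2 : ψ.toFun (ψ.invFun z) = z := ψ.right_inv' (by rw [ht]; exact hz)
    rw [← hψ _ h1, h2]
  · refine ⟨(ψ.toFun m).2, ?_⟩
    rw [← hψ m hm]
    exact ψ.left_inv' (by rw [hs]; exact hm)

theorem IsFibreBundle.surjective [Nonempty Φ] (hπ : IsFibreBundle EΦ Φ π) :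
    Function.Surjective π := by
  intro n
  obtain ⟨U, -, hn, σ, -, hσ, -⟩ := hπ.exists_sections n
  exact ⟨σ (n, Classical.arbitrary Φ), hσ (n, Classical.arbitrary Φ) ⟨hn, trivial⟩⟩

/-- Through every point of `M` there is a smooth local section. -/
theorem IsFibreBundle.exists_section (hπ : IsFibreBundle EΦ Φ π) (m : M) :
    ∃ U : Set N, IsOpen U ∧ π m ∈ U ∧ ∃ σ : N → M, ContMDiffOn 𝓘(ℝ, EN) 𝓘(ℝ, EM) ∞ σ U ∧
      (∀ n ∈ U, π (σ n) = n) ∧ σ (π m) = m := by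
  obtain ⟨U, hU, hn, σ, hsm, hσ, hex⟩ := hπ.exists_sections (π m)
  obtain ⟨y, hy⟩ := hex m hn
  exact ⟨U, hU, hn, fun n => σ (n, y),
    hsm.comp (contMDiff_id.prodMk contMDiff_const).contMDiffOn fun n hn => ⟨hn, trivial⟩,
    fun n hn => hσ (n, y) ⟨hn, trivial⟩, hy⟩

theorem projDeriv_mfderiv_section {U : Set N} (hU : IsOpen U) {σ : N → M}
    (hσ : ContMDiffOn 𝓘(ℝ, EN) 𝓘(ℝ, EM) ∞ σ U) (hsec : ∀ n ∈ U, π (σ n) = n) {n : N} (hn : n ∈ U)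
    (v : EN) : projDeriv π (σ n) (mfderiv 𝓘(ℝ, EN) 𝓘(ℝ, EM) σ n v) = v := by
  have h1 : MDifferentiableAt 𝓘(ℝ, EN) 𝓘(ℝ, EM) σ n :=
    (hσ.contMDiffAt (hU.mem_nhds hn)).mdifferentiableAt (by simp)
  have h2 : MDifferentiableAt 𝓘(ℝ, EM) 𝓘(ℝ, EN) π (σ n) :=
    π.contMDiff.mdifferentiable (by simp) _
  have h3 := h2.hasMFDerivAt.comp n h1.hasMFDerivAt
  have h4 : HasMFDerivAt 𝓘(ℝ, EN) 𝓘(ℝ, EN) (π ∘ σ) n (ContinuousLinearMap.id ℝ EN) := by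
    refine (hasMFDerivAt_id n).congr_of_eventuallyEq ?_
    filter_upwards [hU.mem_nhds hn] with n' hn' using hsec n' hn'
  exact DFunLike.congr_fun (hasMFDerivAt_unique h3 h4) v

/-- The differential of a local section through `m` is a right inverse of that of `π`. -/
theorem IsFibreBundle.surjective_projDeriv (hπ : IsFibreBundle EΦ Φ π) (m : M) :
    Function.Surjective (projDeriv π m) := by
  intro v
  obtain ⟨U, hU, hn, σ, hsm, hσ, hm⟩ := hπ.exists_section m
  have h := projDeriv_mfderiv_section hU hsm hσ hn v
  rw [hm] at h
  exact ⟨_, h⟩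

end FibreBundle

/-! ### Constancy of the length of horizontal lifts along the fibres -/

section Descent

set_option linter.unusedSectionVars false

variable {EM : Type*} [NormedAddCommGroup EM] [NormedSpace ℝ EM] [FiniteDimensional ℝ EM]
  {M : Type*} [TopologicalSpace M] [T2Space M] [ChartedSpace EM M] [IsManifold 𝓘(ℝ, EM) ∞ M]
  {EN : Type*} [NormedAddCommGroup EN] [NormedSpace ℝ EN] [FiniteDimensional ℝ EN]
  {N : Type*} [TopologicalSpace N] [ChartedSpace EN N] [IsManifold 𝓘(ℝ, EN) ∞ N]
  {EΦ : Type*} [NormedAddCommGroup EΦ] [NormedSpace ℝ EΦ]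
  {Φ : Type*} [TopologicalSpace Φ] [ChartedSpace EΦ Φ] [IsManifold 𝓘(ℝ, EΦ) ∞ Φ]
  {π : C^∞⟮𝓘(ℝ, EM), M; 𝓘(ℝ, EN), N⟯} {F : TangentBundle 𝓘(ℝ, EM) M → ℝ}

/-- Along a smooth map `σ` into a fibre of `π` the energy of the horizontal lift of a fixed vector
has zero differential, if the canonical spray is tangent to the image of the splitting. -/
theorem hasMFDerivAt_energy_horizontalLift_fibre (hF : IsFinsler F)
    (hsurj : ∀ m, Function.Surjective (projDeriv π m))
    (htan : IsTangentToImage π (horizontalMap π F) (canonicalSpray F)) {σ : Φ → M} {n : N}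
    (hσ : ContMDiff 𝓘(ℝ, EΦ) 𝓘(ℝ, EM) ∞ σ) (hσn : ∀ y, π (σ y) = n) {v : EN} (hv : v ≠ 0) (y : Φ) :
    HasMFDerivAt 𝓘(ℝ, EΦ) 𝓘(ℝ, ℝ)
      (fun y => energy F (horizontalMap π F (⟨σ y, v⟩ : PullbackTangent π))) y
      (0 : EΦ →L[ℝ] ℝ) := by
  set p : PullbackTangent π := ⟨σ y, v⟩ with hp
  have hps : p ∈ slitPullback π := hv
  obtain ⟨g, lam, H, hev⟩ := exists_isLocalSplitting_horizontalLift hF hsurj p hps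
  have hC := (canonicalSpray_mem_range_iff hF hsurj hps H hev).1 (htan p hps)
  obtain ⟨D, hD, hDC⟩ := H.hasFDerivAt_energy_splitting
  have hD0 : ∀ a, projDeriv π (σ y) a = 0 → D a = 0 := fun a ha =>
    (hDC a).trans (hC a ha)
  have hcurve : ContMDiff 𝓘(ℝ, EΦ) (𝓘(ℝ, EM).prod 𝓘(ℝ, EN)) ∞
      (fun y => (⟨σ y, v⟩ : PullbackTangent π)) := by
    intro y
    refine (contMDiffAt_pullback_iff π).2 ⟨hσ y, ?_⟩
    have h1 : (fun y => pullbackToTN π (⟨σ y, v⟩ : PullbackTangent π)) =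
        fun _ => (⟨n, v⟩ : TangentBundle 𝓘(ℝ, EN) N) := by
      ext1 y
      exact congrArg (fun n => (⟨n, v⟩ : TangentBundle 𝓘(ℝ, EN) N)) (hσn y)
    rw [h1]
    exact contMDiffAt_const
  have hσd : HasMFDerivAt 𝓘(ℝ, EΦ) 𝓘(ℝ, EM) σ y (mfderiv 𝓘(ℝ, EΦ) 𝓘(ℝ, EM) σ y) :=
    (hσ.mdifferentiable (by simp) y).hasMFDerivAt
  have hvert : ∀ η : EΦ, projDeriv π (σ y) (mfderiv 𝓘(ℝ, EΦ) 𝓘(ℝ, EM) σ y η) = 0 := by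
    intro η
    have h2 : MDifferentiableAt 𝓘(ℝ, EM) 𝓘(ℝ, EN) π (σ y) :=
      π.contMDiff.mdifferentiable (by simp) _
    have h3 := h2.hasMFDerivAt.comp y hσd
    have h4 : HasMFDerivAt 𝓘(ℝ, EΦ) 𝓘(ℝ, EN) (π ∘ σ) y (0 : EΦ →L[ℝ] EN) := by
      have h5 : (π ∘ σ) = fun _ => n := funext hσn
      rw [h5]
      exact hasMFDerivAt_const n y
    exact DFunLike.congr_fun (hasMFDerivAt_unique h3 h4) η
  have hchart : HasMFDerivAt 𝓘(ℝ, EΦ) 𝓘(ℝ, EM) (fun y' => extChartAt 𝓘(ℝ, EM) (σ y) (σ y')) y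
      (mfderiv 𝓘(ℝ, EΦ) 𝓘(ℝ, EM) σ y) := by
    have h6 : MDifferentiableAt 𝓘(ℝ, EM) 𝓘(ℝ, EM) (extChartAt 𝓘(ℝ, EM) (σ y)) (σ y) :=
      mdifferentiableAt_extChartAt (mem_chart_source EM (σ y))
    have h7 := h6.hasMFDerivAt.comp y hσd
    rw [mfderiv_extChartAt_self] at h7
    exact h7
  have hfun : HasMFDerivAt 𝓘(ℝ, EΦ) 𝓘(ℝ, ℝ) (fun y' => (energy F ∘ tangentChartSymm EM p.proj)
      (extChartAt 𝓘(ℝ, EM) (σ y) (σ y'), g (extChartAt 𝓘(ℝ, EM) (σ y) (σ y'), v))) y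
      (0 : EΦ →L[ℝ] ℝ) :=
    hasMFDerivAt_comp_eq_zero (E := EΦ)
      (K := fun x => (energy F ∘ tangentChartSymm EM p.proj) (x, g (x, v)))
      (c := fun y' => extChartAt 𝓘(ℝ, EM) (σ y) (σ y')) hD hchart fun η => hD0 _ (hvert η)
  refine hfun.congr_of_eventuallyEq ?_
  have h8 : ∀ᶠ y' in 𝓝 y, σ y' ∈ (chartAt EM (σ y)).source :=
    hσ.continuous.continuousAt.eventually
      ((chartAt EM (σ y)).open_source.eventually_mem (mem_chart_source EM (σ y)))
  filter_upwards [hcurve.continuous.continuousAt.eventually hev, h8] with y' hy' hy''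
  have h9 : fibreCoord EN (π p.proj) (pullbackToTN π (⟨σ y', v⟩ : PullbackTangent π)) = v := by
    have h10 : (π (σ y)) = π (σ y') := (hσn y).trans (hσn y').symm
    have h11 : pullbackToTN π (⟨σ y', v⟩ : PullbackTangent π) = ⟨π (σ y), v⟩ :=
      congrArg (fun n => (⟨n, v⟩ : TangentBundle 𝓘(ℝ, EN) N)) h10.symm
    rw [h11]
    exact fibreCoord_self (π (σ y)) v
  rw [h9] at hy'
  have h12 := tangentChartSymm_fibreCoord (E := EM) (m₀ := σ y)
    (w := horizontalMap π F (⟨σ y', v⟩ : PullbackTangent π)) hy''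
  refine congrArg (energy F) (h12.symm.trans ?_)
  exact congrArg (fun z => tangentChartSymm EM (σ y) (extChartAt 𝓘(ℝ, EM) (σ y) (σ y'), z)) hy'

/-- As the fibres are connected, the length of the horizontal lift of `v` does not depend on the
point to which `v` is lifted. -/
theorem map_horizontalLift_eq [ConnectedSpace Φ] (hπ : IsFibreBundle EΦ Φ π) (hF : IsFinsler F)
    (htan : IsTangentToImage π (horizontalMap π F) (canonicalSpray F)) {m m' : M}
    (hm : π m = π m') (v : EN) :
    F (horizontalMap π F (⟨m, v⟩ : PullbackTangent π)) =
      F (horizontalMap π F (⟨m', v⟩ : PullbackTangent π)) := by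
  have hsurj := hπ.surjective_projDeriv
  by_cases hv : v = 0
  · subst hv
    have h1 : ∀ m : M, F (horizontalMap π F (⟨m, (0 : EN)⟩ : PullbackTangent π)) = 0 := fun m => by
      rw [horizontalMap_of_notMem hF hsurj (fun h => h rfl)]
      exact hF.map_zero m
    rw [h1, h1]
  · obtain ⟨U, hU, hn, σ, hsm, hσ, hex⟩ := hπ.exists_sections (π m)
    obtain ⟨y, hy⟩ := hex m hn
    obtain ⟨y', hy'⟩ := hex m' (hm ▸ hn)
    rw [← hm] at hy'
    have hσ' : ContMDiff 𝓘(ℝ, EΦ) 𝓘(ℝ, EM) ∞ fun y => σ (π m, y) := by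
      rw [← contMDiffOn_univ]
      exact hsm.comp (contMDiff_const.prodMk contMDiff_id).contMDiffOn fun y _ => ⟨hn, trivial⟩
    have hloc := isLocallyConstant_of_hasMFDerivAt_zero
      (hasMFDerivAt_energy_horizontalLift_fibre hF hsurj htan hσ'
        (fun y => hσ (π m, y) ⟨hn, trivial⟩) hv)
    have h2 := hloc.apply_eq_of_isPreconnected isPreconnected_univ (mem_univ y) (mem_univ y')
    replace h2 : energy F (horizontalMap π F (⟨σ (π m, y), v⟩ : PullbackTangent π)) =
        energy F (horizontalMap π F (⟨σ (π m, y'), v⟩ : PullbackTangent π)) := h2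
    rw [hy, hy'] at h2
    exact le_antisymm ((hF.energy_le_iff _ _).1 h2.le) ((hF.energy_le_iff _ _).1 h2.ge)

end Descent

/-! ### Closed unit balls -/

section ClosedBall

variable {E : Type*} [NormedAddCommGroup E] [NormedSpace ℝ E]
  {M : Type*} [TopologicalSpace M] [ChartedSpace E M] [IsManifold 𝓘(ℝ, E) ∞ M]

/-- By homogeneity, the closure of the open unit ball is the sublevel set `F ≤ 1`. -/
theorem IsFinsler.mem_closedUnitBall_iff {F : TangentBundle 𝓘(ℝ, E) M → ℝ} (hF : IsFinsler F)
    (m : M) (u : E) :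
    u ∈ closedUnitBall F m ↔ F (⟨m, u⟩ : TangentBundle 𝓘(ℝ, E) M) ≤ 1 := by
  constructor
  · intro h
    have hcont : Continuous fun u : TangentSpace 𝓘(ℝ, E) m =>
        F (⟨m, u⟩ : TangentBundle 𝓘(ℝ, E) M) :=
      hF.continuous.comp (FiberBundle.continuous_totalSpaceMk E
        (TangentSpace 𝓘(ℝ, E) : M → Type _) m)
    exact closure_minimal (fun w (hw : F ⟨m, w⟩ < 1) => hw.le)
      (isClosed_le hcont continuous_const) h
  · intro h
    have hc : Tendsto (fun c : ℝ => c • u) (𝓝[<] 1) (𝓝 u) := by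
      have : Tendsto (fun c : ℝ => c • u) (𝓝 1) (𝓝 ((1 : ℝ) • u)) :=
        (continuous_id.smul continuous_const).tendsto 1
      rw [one_smul] at this
      exact this.mono_left nhdsWithin_le_nhds
    refine mem_closure_of_tendsto hc ?_
    filter_upwards [Ioo_mem_nhdsLT (show (0 : ℝ) < 1 by norm_num)] with c hc
    have h1 : F (⟨m, c • u⟩ : TangentBundle 𝓘(ℝ, E) M) = c * F ⟨m, u⟩ :=
      hF.homogeneous m u c hc.1
    change F (⟨m, c • u⟩ : TangentBundle 𝓘(ℝ, E) M) < 1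
    rw [h1]
    calc c * F ⟨m, u⟩ ≤ c * 1 := mul_le_mul_of_nonneg_left h hc.1.le
      _ < 1 := by rw [mul_one]; exact hc.2

end ClosedBall

/-! ### The Finsler function on the base -/

section Quotient

set_option linter.unusedSectionVars false

variable {EM : Type*} [NormedAddCommGroup EM] [NormedSpace ℝ EM] [FiniteDimensional ℝ EM]
  {M : Type*} [TopologicalSpace M] [T2Space M] [ChartedSpace EM M] [IsManifold 𝓘(ℝ, EM) ∞ M]
  {EN : Type*} [NormedAddCommGroup EN] [NormedSpace ℝ EN] [FiniteDimensional ℝ EN]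
  {N : Type*} [TopologicalSpace N] [ChartedSpace EN N] [IsManifold 𝓘(ℝ, EN) ∞ N]
  {EΦ : Type*} [NormedAddCommGroup EΦ] [NormedSpace ℝ EΦ]
  {Φ : Type*} [TopologicalSpace Φ] [ChartedSpace EΦ Φ] [IsManifold 𝓘(ℝ, EΦ) ∞ Φ]
  {π : C^∞⟮𝓘(ℝ, EM), M; 𝓘(ℝ, EN), N⟯} {F : TangentBundle 𝓘(ℝ, EM) M → ℝ}
  {F₂ : TangentBundle 𝓘(ℝ, EN) N → ℝ}

/-- A function to which the length of the horizontal lifts descends is bounded by the length of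
arbitrary lifts. -/
theorem descended_le (hF : IsFinsler F) (hsurj : ∀ m, Function.Surjective (projDeriv π m))
    (hdesc : ∀ p, F₂ (pullbackToTN π p) = F (horizontalMap π F p)) (m : M) (u : EM) :
    F₂ (⟨π m, projDeriv π m u⟩ : TangentBundle 𝓘(ℝ, EN) N) ≤ F ⟨m, u⟩ :=
  (hdesc (⟨m, projDeriv π m u⟩ : PullbackTangent π)).le.trans
    (map_horizontalLift_le hF hsurj m u)

/-- With a local section `σ` of `π`, the descended function is `v ↦ F (h (σ n, v))` over `n`,
which is smooth at the nonzero vectors. -/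
theorem contMDiffAt_descended (hπ : IsFibreBundle EΦ Φ π) (hF : IsFinsler F)
    (hdesc : ∀ p, F₂ (pullbackToTN π p) = F (horizontalMap π F p)) (m : M) {v : EN} (hv : v ≠ 0) :
    ContMDiffAt 𝓘(ℝ, EN).tangent 𝓘(ℝ, ℝ) ∞ F₂ (⟨π m, v⟩ : TangentBundle 𝓘(ℝ, EN) N) := by
  have hsurj := hπ.surjective_projDeriv
  obtain ⟨U, hU, hn, σ, hsm, hσ, hm⟩ := hπ.exists_section m
  let G : TangentBundle 𝓘(ℝ, EN) N → PullbackTangent π := fun w => ⟨σ w.proj, (w.2 : EN)⟩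
  have hUw : ∀ᶠ w : TangentBundle 𝓘(ℝ, EN) N in 𝓝 (⟨π m, v⟩ : TangentBundle 𝓘(ℝ, EN) N),
      w.proj ∈ U :=
    (FiberBundle.continuous_proj EN (TangentSpace 𝓘(ℝ, EN) : N → Type _)).continuousAt.eventually
      (hU.eventually_mem hn)
  have hGlift : ∀ w : TangentBundle 𝓘(ℝ, EN) N, w.proj ∈ U → pullbackToTN π (G w) = w :=
    fun w hw => congrArg (fun n => (⟨n, (w.2 : EN)⟩ : TangentBundle 𝓘(ℝ, EN) N)) (hσ w.proj hw)
  have hG : ContMDiffAt 𝓘(ℝ, EN).tangent (𝓘(ℝ, EM).prod 𝓘(ℝ, EN)) ∞ G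
      (⟨π m, v⟩ : TangentBundle 𝓘(ℝ, EN) N) := by
    refine (contMDiffAt_pullback_iff π).2 ⟨?_, ?_⟩
    · exact ContMDiffAt.comp (g := σ) (⟨π m, v⟩ : TangentBundle 𝓘(ℝ, EN) N)
        (hsm.contMDiffAt (hU.mem_nhds hn))
        (Bundle.contMDiffAt_proj (TangentSpace 𝓘(ℝ, EN) : N → Type _))
    · refine contMDiffAt_id.congr_of_eventuallyEq ?_
      filter_upwards [hUw] with w hw using hGlift w hw
  have hGs : G (⟨π m, v⟩ : TangentBundle 𝓘(ℝ, EN) N) ∈ slitPullback π := hv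
  have hne : horizontalLift (EM := EM) π F (σ (π m)) v ≠ 0 := horizontalLift_ne_zero hF hsurj hv
  have hF' : ContMDiffAt 𝓘(ℝ, EM).tangent 𝓘(ℝ, ℝ) ∞ F
      (horizontalMap π F (G (⟨π m, v⟩ : TangentBundle 𝓘(ℝ, EN) N))) :=
    hF.smooth.contMDiffAt (isOpen_slitTangent.mem_nhds hne)
  have h0 := ContMDiffAt.comp (⟨π m, v⟩ : TangentBundle 𝓘(ℝ, EN) N)
    (contMDiffAt_horizontalMap hF hsurj hGs) hG
  have h1 := ContMDiffAt.comp (g := F) (f := horizontalMap π F ∘ G)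
    (⟨π m, v⟩ : TangentBundle 𝓘(ℝ, EN) N) hF' h0
  refine h1.congr_of_eventuallyEq ?_
  filter_upwards [hUw] with w hw
  have h2 := hdesc (G w)
  rw [hGlift w hw] at h2
  exact h2

/-- Smoothness of the splitting holds at nonzero vectors only. At the zero vectors, with a local
section `σ` of `π`, continuity of `F₂` follows from `0 ≤ F₂ ≤ F ∘ Tσ`, as `F₂` is the least length
of a lift. -/
theorem continuousAt_descended_zero (hπ : IsFibreBundle EΦ Φ π) (hF : IsFinsler F)
    (hdesc : ∀ p, F₂ (pullbackToTN π p) = F (horizontalMap π F p)) (m : M) :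
    ContinuousAt F₂ (⟨π m, (0 : EN)⟩ : TangentBundle 𝓘(ℝ, EN) N) := by
  have hsurj := hπ.surjective_projDeriv
  obtain ⟨U, hU, hn, σ, hsm, hσ, hm⟩ := hπ.exists_section m
  have hUw : ∀ᶠ w : TangentBundle 𝓘(ℝ, EN) N in 𝓝 (⟨π m, (0 : EN)⟩ : TangentBundle 𝓘(ℝ, EN) N),
      w.proj ∈ U :=
    (FiberBundle.continuous_proj EN (TangentSpace 𝓘(ℝ, EN) : N → Type _)).continuousAt.eventually
      (hU.eventually_mem hn)
  have h0 : F₂ (⟨π m, (0 : EN)⟩ : TangentBundle 𝓘(ℝ, EN) N) = 0 := by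
    refine (hdesc (⟨m, (0 : EN)⟩ : PullbackTangent π)).trans ?_
    rw [horizontalMap_of_notMem hF hsurj (fun h => h rfl)]
    exact hF.map_zero m
  have hle : ∀ w : TangentBundle 𝓘(ℝ, EN) N, w.proj ∈ U →
      F₂ w ≤ F (tangentMapWithin 𝓘(ℝ, EN) 𝓘(ℝ, EM) σ U w) ∧ 0 ≤ F₂ w := by
    rintro ⟨n, v⟩ hw
    have hw' : n ∈ U := hw
    have h2 : (⟨π (σ n), v⟩ : TangentBundle 𝓘(ℝ, EN) N) = ⟨n, v⟩ :=
      congrArg (fun n => (⟨n, (v : EN)⟩ : TangentBundle 𝓘(ℝ, EN) N)) (hσ n hw')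
    have h3 := hdesc (⟨σ n, v⟩ : PullbackTangent π)
    have h4 : pullbackToTN π (⟨σ n, v⟩ : PullbackTangent π) =
      (⟨n, v⟩ : TangentBundle 𝓘(ℝ, EN) N) := h2
    rw [h4] at h3
    constructor
    · have h5 := descended_le hF hsurj hdesc (σ n) (mfderiv 𝓘(ℝ, EN) 𝓘(ℝ, EM) σ n v)
      rw [projDeriv_mfderiv_section hU hsm hσ hw' v] at h5
      have h6 : tangentMapWithin 𝓘(ℝ, EN) 𝓘(ℝ, EM) σ U (⟨n, v⟩ : TangentBundle 𝓘(ℝ, EN) N) =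
          ⟨σ n, mfderiv 𝓘(ℝ, EN) 𝓘(ℝ, EM) σ n v⟩ := by
        unfold tangentMapWithin
        rw [mfderivWithin_of_mem_nhds (hU.mem_nhds hw')]
      rw [h6]
      exact (congrArg F₂ h2).symm.le.trans h5
    · rw [h3]
      exact hF.nonneg _
  have hcont : ContinuousAt (fun w => F (tangentMapWithin 𝓘(ℝ, EN) 𝓘(ℝ, EM) σ U w))
      (⟨π m, (0 : EN)⟩ : TangentBundle 𝓘(ℝ, EN) N) := by
    have h7 := hsm.continuousOn_tangentMapWithin (by simp) hU.uniqueMDiffOn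
    refine hF.continuous.continuousAt.comp (h7.continuousAt ?_)
    exact (hU.preimage (FiberBundle.continuous_proj EN
      (TangentSpace 𝓘(ℝ, EN) : N → Type _))).mem_nhds hn
  have hlim : F (tangentMapWithin 𝓘(ℝ, EN) 𝓘(ℝ, EM) σ U
      (⟨π m, (0 : EN)⟩ : TangentBundle 𝓘(ℝ, EN) N)) = 0 := by
    have h8 : tangentMapWithin 𝓘(ℝ, EN) 𝓘(ℝ, EM) σ U
        (⟨π m, (0 : EN)⟩ : TangentBundle 𝓘(ℝ, EN) N) = ⟨σ (π m), (0 : EM)⟩ :=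
      congrArg (TotalSpace.mk (σ (π m))) (map_zero _)
    rw [h8]
    exact hF.map_zero _
  have hcont' := hcont.tendsto
  rw [hlim] at hcont'
  rw [ContinuousAt, h0]
  refine tendsto_of_tendsto_of_tendsto_of_le_of_le' tendsto_const_nhds hcont' ?_ ?_
  · filter_upwards [hUw] with w hw using (hle w hw).2
  · filter_upwards [hUw] with w hw using (hle w hw).1

theorem descended_hessian_pos (hF : IsFinsler F) (hsurj : ∀ m, Function.Surjective (projDeriv π m))
    (hdesc : ∀ p, F₂ (pullbackToTN π p) = F (horizontalMap π F p)) (m : M) {v w : EN} (hv : v ≠ 0)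
    (hw : w ≠ 0) :
    0 < iteratedDeriv 2
      (fun t : ℝ => energy F₂ (⟨π m, v + t • w⟩ : TangentBundle 𝓘(ℝ, EN) N)) 0 := by
  obtain ⟨g, lam, H, hev⟩ := exists_isLocalSplitting_horizontalLift hF hsurj
    (⟨m, v⟩ : PullbackTangent π) hv
  refine (H.iteratedDeriv_two_energy_pos hw).trans_eq (EventuallyEq.iteratedDeriv_eq 2 ?_)
  have hc : Continuous fun t : ℝ => (⟨m, v + t • w⟩ : PullbackTangent π) := by
    have h1 : Continuous fun v : EN => (⟨m, v⟩ : PullbackTangent π) :=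
      FiberBundle.continuous_totalSpaceMk EN (π *ᵖ (TangentSpace 𝓘(ℝ, EN) : N → Type _)) m
    exact h1.comp (continuous_const.add (continuous_id.smul continuous_const))
  have hc0 : Tendsto (fun t : ℝ => (⟨m, v + t • w⟩ : PullbackTangent π)) (𝓝 0)
      (𝓝 (⟨m, v⟩ : PullbackTangent π)) := by
    have h2 := hc.tendsto 0
    rwa [zero_smul, add_zero] at h2
  filter_upwards [hc0.eventually hev] with t ht
  have h3 : energy F₂ (⟨π m, v + t • w⟩ : TangentBundle 𝓘(ℝ, EN) N) =
      energy F (horizontalMap π F (⟨m, v + t • w⟩ : PullbackTangent π)) :=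
    congrArg (fun x : ℝ => (1 / 2) * x ^ 2) (hdesc (⟨m, v + t • w⟩ : PullbackTangent π))
  have h4 : fibreCoord EN (π m) (pullbackToTN π (⟨m, v + t • w⟩ : PullbackTangent π)) =
      v + t • w := fibreCoord_self (π m) (v + t • w)
  rw [h3]
  refine congrArg (energy F) ?_
  have h5 := tangentChartSymm_fibreCoord (E := EM) (m₀ := m)
    (w := horizontalMap π F (⟨m, v + t • w⟩ : PullbackTangent π)) (mem_chart_source EM m)
  refine Eq.trans ?_ h5
  refine congrArg (fun z => tangentChartSymm EM m (extChartAt 𝓘(ℝ, EM) m m, z)) ?_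
  refine Eq.trans ?_ ht.symm
  exact congrArg (fun z => g (extChartAt 𝓘(ℝ, EM) m m, z)) h4.symm

theorem isFinsler_descended [Nonempty Φ] (hπ : IsFibreBundle EΦ Φ π) (hF : IsFinsler F)
    (hdesc : ∀ p, F₂ (pullbackToTN π p) = F (horizontalMap π F p)) : IsFinsler F₂ := by
  have hsurj := hπ.surjective_projDeriv
  refine ⟨?_, ?_, ?_, ?_, ?_⟩
  · rintro ⟨n, v⟩
    obtain ⟨m, rfl⟩ := hπ.surjective n
    exact (hF.nonneg _).trans_eq (hdesc (⟨m, v⟩ : PullbackTangent π)).symm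
  · refine continuous_iff_continuousAt.2 ?_
    rintro ⟨n, v⟩
    obtain ⟨m, rfl⟩ := hπ.surjective n
    change EN at v
    by_cases hv : v = 0
    · subst hv
      exact continuousAt_descended_zero hπ hF hdesc m
    · exact (contMDiffAt_descended hπ hF hdesc m hv).continuousAt
  · intro n v c hc
    obtain ⟨m, rfl⟩ := hπ.surjective n
    have h1 := hF.homogeneous m (horizontalLift (EM := EM) (EN := EN) π F m v) c hc
    have h2 := hdesc (⟨m, c • v⟩ : PullbackTangent π)
    have h3 := hdesc (⟨m, v⟩ : PullbackTangent π)
    refine h2.trans (Eq.trans ?_ (congrArg (c * ·) h3.symm))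
    refine Eq.trans ?_ h1
    exact congrArg (fun u : EM => F (⟨m, u⟩ : TangentBundle 𝓘(ℝ, EM) M))
      (horizontalLift_smul hF hsurj m v hc)
  · rintro ⟨n, v⟩ hv
    obtain ⟨m, rfl⟩ := hπ.surjective n
    exact (contMDiffAt_descended hπ hF hdesc m hv).contMDiffWithinAt
  · intro n v w hv hw
    obtain ⟨m, rfl⟩ := hπ.surjective n
    exact descended_hessian_pos hF hsurj hdesc m hv hw

theorem isFinslerSubmersion_descended [Nonempty Φ] (hπ : IsFibreBundle EΦ Φ π) (hF : IsFinsler F)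
    (hdesc : ∀ p, F₂ (pullbackToTN π p) = F (horizontalMap π F p)) :
    IsFinslerSubmersion π F F₂ := by
  have hsurj := hπ.surjective_projDeriv
  have hF₂ := isFinsler_descended hπ hF hdesc
  refine ⟨hF, hF₂, hπ.surjective, hsurj, fun m => Set.ext fun v => ?_⟩
  constructor
  -- The image of the ball lies in the ball as `F₂` is bounded by the length of any lift, and a
  -- vector of the ball is the image of its horizontal lift.
  · rintro ⟨u, hu, rfl⟩
    exact (hF₂.mem_closedUnitBall_iff (π m) (projDeriv π m u)).2
      ((descended_le hF hsurj hdesc m u).trans ((hF.mem_closedUnitBall_iff m u).1 hu))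
  · intro hv
    refine ⟨horizontalLift (EM := EM) (EN := EN) π F m v,
      (hF.mem_closedUnitBall_iff m _).2 ?_, projDeriv_horizontalLift hF hsurj m v⟩
    exact (hdesc (⟨m, v⟩ : PullbackTangent π)).symm.le.trans
      ((hF₂.mem_closedUnitBall_iff (π m) v).1 hv)

/-- As `F ∘ h` is constant along the fibres, its values along any section of `π`, continuous or not,
define the descended function. -/
theorem exists_descended [ConnectedSpace Φ] (hπ : IsFibreBundle EΦ Φ π) (hF : IsFinsler F)
    (htan : IsTangentToImage π (horizontalMap π F) (canonicalSpray F)) :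
    ∃ F₂ : TangentBundle 𝓘(ℝ, EN) N → ℝ,
      ∀ p, F₂ (pullbackToTN π p) = F (horizontalMap π F p) := by
  refine ⟨fun w => F (horizontalMap π F
    (⟨Function.surjInv hπ.surjective w.proj, (w.2 : EN)⟩ : PullbackTangent π)), ?_⟩
  rintro ⟨m, v⟩
  exact map_horizontalLift_eq hπ hF htan (Function.surjInv_eq hπ.surjective (π m)) v

end Quotient

end FinslerSplitting

end

theorem mainTheorem5
    {EM : Type*} [NormedAddCommGroup EM] [NormedSpace ℝ EM] [FiniteDimensional ℝ EM]
    {M : Type*} [TopologicalSpace M] [T2Space M] [ChartedSpace EM M] [IsManifold 𝓘(ℝ, EM) ∞ M]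
    {EN : Type*} [NormedAddCommGroup EN] [NormedSpace ℝ EN] [FiniteDimensional ℝ EN]
    {N : Type*} [TopologicalSpace N] [T2Space N] [ChartedSpace EN N] [IsManifold 𝓘(ℝ, EN) ∞ N]
    {EΦ : Type*} [NormedAddCommGroup EΦ] [NormedSpace ℝ EΦ] [FiniteDimensional ℝ EΦ]
    (Φ : Type*) [TopologicalSpace Φ] [ChartedSpace EΦ Φ] [IsManifold 𝓘(ℝ, EΦ) ∞ Φ]
    [ConnectedSpace Φ]
    (π : C^∞⟮𝓘(ℝ, EM), M; 𝓘(ℝ, EN), N⟯)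
    (hπ : FinslerSplitting.IsFibreBundle EΦ Φ π)
    (F₁ : TangentBundle 𝓘(ℝ, EM) M → ℝ) (hF₁ : FinslerSplitting.IsFinsler F₁) :
    -- the induced splitting `h` is a homogeneous nonlinear splitting with the defining relation
    (FinslerSplitting.IsInducedSplitting π F₁ (FinslerSplitting.inducedSplitting π F₁) ∧
      FinslerSplitting.IsHomogeneous π (FinslerSplitting.inducedSplitting π F₁)) ∧
    -- the two forms of the hypothesis are equivalent
    (FinslerSplitting.IsTangentToImage π (FinslerSplitting.inducedSplitting π F₁)
        (FinslerSplitting.canonicalSpray F₁) ↔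
      ∀ Y : (m : M) → TangentSpace 𝓘(ℝ, EM) m, FinslerSplitting.IsVerticalField π Y →
        ∀ p, FinslerSplitting.completeLift Y (FinslerSplitting.energy F₁)
          (FinslerSplitting.inducedSplitting π F₁ p) = 0) ∧
    -- under that hypothesis `F₁ ∘ h` descends to a Finsler function, and `π` is a submersion
    (FinslerSplitting.IsTangentToImage π (FinslerSplitting.inducedSplitting π F₁)
        (FinslerSplitting.canonicalSpray F₁) →
      ∃ F₂ : TangentBundle 𝓘(ℝ, EN) N → ℝ,
        (∀ p, F₂ (FinslerSplitting.pullbackToTN π p)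
          = F₁ (FinslerSplitting.inducedSplitting π F₁ p)) ∧
        FinslerSplitting.IsFinsler F₂ ∧
        FinslerSplitting.IsFinslerSubmersion π F₁ F₂) := by
  have hsurj := hπ.surjective_projDeriv
  rw [FinslerSplitting.inducedSplitting_eq_horizontalMap hF₁ hsurj]
  refine ⟨⟨FinslerSplitting.isInducedSplitting_horizontalMap hF₁ hsurj, fun m v c hc => ?_⟩,
    FinslerSplitting.isTangentToImage_iff hF₁ hsurj, fun htan => ?_⟩
  · exact congrArg (Bundle.TotalSpace.mk m)
      (FinslerSplitting.horizontalLift_smul hF₁ hsurj m v hc)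
  · obtain ⟨F₂, hdesc⟩ := FinslerSplitting.exists_descended hπ hF₁ htan
    exact ⟨F₂, hdesc, FinslerSplitting.isFinsler_descended hπ hF₁ hdesc,
      FinslerSplitting.isFinslerSubmersion_descended hπ hF₁ hdesc⟩
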